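/- **Setting.** Let $\pi: Y\to X$ be a smooth bundle (it is enough that $\pi$ is a surjective submersion) over an $(n+1)$-manifold $X$, let $\Sigma$ be a compact oriented $n$-manifold without boundary and $\tau:\Sigma\to X$ a smooth embedding with image $\Sigma_\tau$; objects over $\Sigma_\tau$ are regarded as objects over $\Sigma$. Let $J^1_yY=\{\gamma\in \mathrm{Hom}(T_{\pi(y)}X,T_yY): T_y\pi\circ\gamma=\mathrm{id}\}$, let $\mathcal L:J^1Y\to\Lambda^{n+1}X$ be a smooth Lagrangian density over $X$, and let $Z\subset\Lambda^{n+1}T^*Y$ be the bundle of those $z$ with $\mathbf i_v\mathbf i_wz=0$ for all vertical $v,w$. The canonical form $\Theta$ on $Z$ is, at $z$, the pullback of $z$ along $Z\to Y$. The covariant Legendre transform $\mathbb F\mathcal L:J^1Y\to Z$ is given by $\gamma'^*\,\mathbb F\mathcal L(\gamma)=\mathcal L(\gamma)+\frac{d}{d\varepsilon}\big|_{0}\mathcal L(\gamma+\varepsilon(\gamma'-\gamma))$ for all $\gamma'\in J^1_yY$. A Lie algebra $\mathfrak g$ acts on $Y$ by the infinitesimal generators of a group of bundle automorphisms: to $\xi\in\mathfrak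 g$ corresponds, linearly, a smooth vector field $\xi_Y$ on $Y$ that projects to a smooth vector field $\xi_X$ on $X$; $\xi_Z$ is the canonical lift of $\xi_Y$ to $Z$. No invariance of $\mathcal L$ is assumed. $\mathcal Y_\tau$ is the set of smooth sections $\varphi:\Sigma_\tau\to Y$ of $Y$ over $\Sigma_\tau$, $T_\varphi\mathcal Y_\tau$ the space of smooth vertical vector fields $\dot\varphi$ along $\varphi$, and $T^*\mathcal Y_\tau$ the set of pairs $(\varphi,\pi)$, where $\varphi\in\mathcal Y_\tau$ and $\pi$ is a smooth section of $L(VY_\tau,\Lambda^n\Sigma_\tau)$ along $\varphi$. Fix an infinitesimal slicing $\zeta$: a smooth vector field $\zeta_Y$ on $Y$ defined over $Y_\tau=\pi^{-1}(\Sigma_\tau)$, projecting to a smooth field $\zeta_X$ along $\Sigma_\tau$ that is everywhere transverse to $\Sigma_\tau$. For $\varphi\in\mathcal Y_\tau$, $x\in\Sigma_\tau$ and $v\in V_{\varphi(x)}Y$ let $\mathcal L_{\tau,\zeta}(j^1\varphi(x),v)=i_\tau^*\mathbf i_{\zeta_X}\mathcal L(\gamma)$, where $\gamma\in J^1_{\varphi(x)}Y$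 is the jet with $\gamma|_{T_x\Sigma_\tau}=T_x\varphi$ and $\gamma(\zeta_X)-\zeta_Y=v$. The instantaneous Legendre transform $\mathbb FL_{\tau,\zeta}:T\mathcal Y_\tau\to T^*\mathcal Y_\tau$, $(\varphi,\dot\varphi)\mapsto(\varphi,\pi)$, takes $\pi(x)$ to be the fibre derivative of $\mathcal L_{\tau,\zeta}(j^1\varphi(x),\cdot)$ at $\dot\varphi(x)$, and $\mathcal P_\tau=\operatorname{im}\mathbb FL_{\tau,\zeta}$ is the primary constraint set. A *holonomic lift* of $(\varphi,\pi)$ is a smooth section $\sigma$ of $Z$ over $\Sigma_\tau$, covering $\varphi$, such that $\varphi^*\mathbf i_v\sigma(x)=\langle\pi(x),v\rangle$ for all $x$ and vertical $v$, and $\sigma=\mathbb F\mathcal L\circ\gamma$ for a holonomic jet $\gamma$ along $\Sigma_\tau$, i.e. a smooth field of jets $\gamma(x)\in J^1_{\varphi(x)}Y$ with $\gamma(x)|_{T_x\Sigma_\tau}=T_x\varphi$. The energy-momentum density of $\sigma$ is the $n$-form $\langle\mathfrak E_\tau(\sigma),\xi\rangle=\sigma^*(\mathbf i_{\xi_Z}\Theta)$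 on $\Sigma_\tau$. Consider the following two conditions. * (A) The fibres of $\mathbb FL_{\tau,\zeta}:T\mathcal Y_\tau\to T^*\mathcal Y_\tau$ are connected: any two points of a fibre can be joined by a smooth curve in that fibre. (This holds under almost regularity, i.e. if $\mathcal P_\tau$ is a smooth closed submanifold of $T^*\mathcal Y_\tau$ onto which $\mathbb FL_{\tau,\zeta}$ is a submersion with connected fibres.) * (B) The same condition pointwise: for all $\varphi\in\mathcal Y_\tau$ and $x\in\Sigma_\tau$, any two points of a fibre of the fibre derivative $V_{\varphi(x)}Y\to L(V_{\varphi(x)}Y,\Lambda^n_x\Sigma_\tau)$ of $\mathcal L_{\tau,\zeta}(j^1\varphi(x),\cdot)$ can be joined by a smooth curve in that fibre. **Proposition 7.7.** 1. Every $(\varphi,\pi)\in\mathcal P_\tau$ has a holonomic lift. 2. Assume (A) or (B). Then the energy-momentum density, evaluated on holonomic lifts, depends only on $(\varphi,\pi)$: there is a unique map $\mathfrak E_\tau$ assigning to each $(\varphi,\pi)\in\mathcal P_\tau$ a linear map $\xi\mapsto\langle\mathfrak E_\tau(\varphi,\pi),\xi\rangle$ from $\mathfrak g$ to the $n$-forms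 on $\Sigma_\tau$ with $\langle\mathfrak E_\tau(\varphi,\pi),\xi\rangle=\sigma^*(\mathbf i_{\xi_Z}\Theta)$ for every holonomic lift $\sigma$ of $(\varphi,\pi)$. These $n$-forms are smooth, and there is a unique map $\mathcal E_\tau:\mathcal P_\tau\to\mathfrak g^*$ with $\langle\mathcal E_\tau(\varphi,\pi),\xi\rangle=\int_{\Sigma_\tau}\langle\mathfrak E_\tau(\varphi,\pi),\xi\rangle$. 3. Assume (B). Then the value of the energy-momentum density at $x$ depends only on $j^1\varphi(x)$ and $\pi(x)$: if $(\varphi,\pi),(\varphi',\pi')\in\mathcal P_\tau$ satisfy $j^1\varphi(x)=j^1\varphi'(x)$ and $\pi(x)=\pi'(x)$, then $\sigma^*(\mathbf i_{\xi_Z}\Theta)(x)=\sigma'^*(\mathbf i_{\xi_Z}\Theta)(x)$ for all holonomic lifts $\sigma$ of $(\varphi,\pi)$ and $\sigma'$ of $(\varphi',\pi')$ and all $\xi\in\mathfrak g$. -/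

import Mathlib

open scoped Manifold ContDiff Topology
open Bundle MeasureTheory

noncomputable section

namespace ClassicalFields

/-! ### Differential forms on manifolds -/

/-- The coordinate space `ℝᵏ`. -/
abbrev Coord (k : ℕ) : Type := EuclideanSpace ℝ (Fin k)

section Forms

variable {d : ℕ} {M : Type*} [TopologicalSpace M] [ChartedSpace (Coord d) M]

/-- `Λᵏ T_p^* M`: the alternating `k`-forms on the tangent space at `p`. -/
abbrev Form (k : ℕ) (p : M) : Type :=
  TangentSpace (𝓡 d) p [⋀^Fin k]→L[ℝ] Bundle.Trivial M ℝ p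

variable [IsManifold (𝓡 d) ∞ M]

variable (d M) in
/-- The total space of the vector bundle `Λᵏ T^*M → M`, with its smooth structure. -/
abbrev FormBundle (k : ℕ) : Type _ :=
  TotalSpace (Coord d [⋀^Fin k]→L[ℝ] ℝ) (fun p : M => Form (d := d) k p)

/-- The model with corners of `FormBundle d M k` (a manifold without boundary). -/
abbrev formModel (d k : ℕ) :=
  (𝓡 d).prod 𝓘(ℝ, Coord d [⋀^Fin k]→L[ℝ] ℝ)

/-- The interior product `𝐢_v α` of a `(k+1)`-form with a vector. -/
def interiorProduct {E : Type*} [NormedAddCommGroup E] [NormedSpace ℝ E] {k : ℕ}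
    (v : E) (α : E [⋀^Fin (k + 1)]→L[ℝ] ℝ) : E [⋀^Fin k]→L[ℝ] ℝ :=
  α.curryLeft v

/-- The canonical form on `Λᵏ T^*M`: at the point `z` it is the pullback of the form `z` itself
along the bundle projection `Λᵏ T^*M → M`. -/
def canonicalForm {k : ℕ} (z : FormBundle d M k) :
    TangentSpace (formModel d k) z [⋀^Fin k]→L[ℝ] ℝ :=
  z.2.compContinuousLinearMap
    (mfderiv (formModel d k) (𝓡 d) (TotalSpace.proj : FormBundle d M k → M) z)

/-- The derivative at `p` of the components of a vector field in the preferred chart at `p`. -/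
def componentDeriv (ξ : ∀ p : M, TangentSpace (𝓡 d) p) (p : M) : Coord d →L[ℝ] Coord d :=
  mfderiv (𝓡 d) 𝓘(ℝ, Coord d)
    (fun q : M => (trivializationAt (Coord d) (TangentSpace (𝓡 d) : M → Type) p ⟨q, ξ q⟩).2) p

/-- The canonical lift to `Λᵏ T^*M` of a vector field `ξ` on `M`, i.e. the generator of the flow
`z ↦ (η_t⁻¹)^* z` obtained by lifting the flow `η_t` of `ξ`.  It is written in the chart of the
bundle induced by the preferred chart at the base point, in which `T_z Λᵏ T^*M` is
`ℝᵈ × Λᵏ(ℝᵈ)^*`: the base component is `ξ`, and the fibre component is the derivative at `t = 0`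
of the pullback of `z` by the linearization `1 - t Dξ` of `η_t⁻¹`. -/
def canonicalLift {k : ℕ} (ξ : ∀ p : M, TangentSpace (𝓡 d) p) (z : FormBundle d M k) :
    TangentSpace (formModel d k) z :=
  show Coord d × (Coord d [⋀^Fin k]→L[ℝ] ℝ) from
    (ξ z.1,
      deriv (fun t : ℝ => (show Coord d [⋀^Fin k]→L[ℝ] ℝ from z.2).compContinuousLinearMap
        (ContinuousLinearMap.id ℝ (Coord d) - t • componentDeriv ξ z.1)) 0)

end Forms

section Integral

variable {n : ℕ} (S : Type*) [TopologicalSpace S] [ChartedSpace (Coord n) S]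
  [IsManifold (𝓡 n) ∞ S]

/-- `S` is oriented by its atlas: all changes of charts have positive Jacobian determinant. -/
def IsOrientedAtlas : Prop :=
  ∀ (e e' : atlas (Coord n) S) (x : S), x ∈ e.1.source → x ∈ e'.1.source →
    0 < ((tangentBundleCore (𝓡 n) S).coordChange e e' x).det

variable [CompactSpace S] [T2Space S]

/-- A smooth partition of unity subordinate to the preferred charts. -/
def chartPartition : SmoothPartitionOfUnity S (𝓡 n) S Set.univ :=
  Classical.choose (SmoothPartitionOfUnity.exists_isSubordinate_chartAt_source (𝓡 n) S)

variable {S}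

/-- The integral of an `n`-form over the compact `n`-manifold `S` oriented by its atlas:
`∑_c ∫ ρ_c(x) α(∂₁, …, ∂ₙ) dx¹ ⋯ dxⁿ`, where `ρ` is a partition of unity subordinate to the charts
and `∂₁, …, ∂ₙ` is the coordinate frame of the chart `c`. -/
def integralForm (α : ∀ x : S, Form (d := n) n x) : ℝ :=
  ∑ᶠ c : S, ∫ u in (extChartAt (𝓡 n) c).target,
    (chartPartition (n := n) S c ((extChartAt (𝓡 n) c).symm u) : ℝ) *
      (show ℝ from α ((extChartAt (𝓡 n) c).symm u) (fun i : Fin n =>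
        (trivializationAt (Coord n) (TangentSpace (𝓡 n) : S → Type) c).symmL ℝ
          ((extChartAt (𝓡 n) c).symm u) (EuclideanSpace.single i (1 : ℝ))))

end Integral

/-! ### The covariant theory: jets, Lagrangian densities, multimomenta -/

section Covariant

variable {n m : ℕ} {X Y : Type*}
  [TopologicalSpace X] [ChartedSpace (Coord (n + 1)) X] [IsManifold (𝓡 (n + 1)) ∞ X]
  [TopologicalSpace Y] [ChartedSpace (Coord m) Y] [IsManifold (𝓡 m) ∞ Y]

/-- The configuration bundle: a surjective submersion `Y → X`. -/
structure IsFibered (pr : C^∞⟮𝓡 m, Y; 𝓡 (n + 1), X⟯) : Prop where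
  surjective : Function.Surjective pr
  submersion : ∀ y, Function.Surjective (mfderiv (𝓡 m) (𝓡 (n + 1)) pr y)

/-- The fibre of a pullback of a vector bundle is a commutative group. -/
instance pullbackAddCommGroup {B B' : Type*} (f : B' → B) (E : B → Type*)
    [∀ x, AddCommGroup (E x)] (y : B') : AddCommGroup ((f *ᵖ E) y) :=
  inferInstanceAs (AddCommGroup (E (f y)))

variable (pr : C^∞⟮𝓡 m, Y; 𝓡 (n + 1), X⟯)

/-- The vertical tangent space `V_y Y`, the kernel of `T_y π`. -/
def Vertical (y : Y) : Submodule ℝ (TangentSpace (𝓡 m) y) :=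
  LinearMap.ker (mfderiv (𝓡 m) (𝓡 (n + 1)) pr y).toLinearMap

/-- The linear maps `T_{π(y)} X → T_y Y`. -/
abbrev PreJet (y : Y) : Type := TangentSpace (𝓡 (n + 1)) (pr y) →L[ℝ] TangentSpace (𝓡 m) y

/-- The total space of the vector bundle `Hom(π^*TX, TY) → Y`, which contains `J¹Y`. -/
abbrev PreJetBundle : Type _ :=
  TotalSpace (Coord (n + 1) →L[ℝ] Coord m)
    (fun y : Y => ((pr : Y → X) *ᵖ (TangentSpace (𝓡 (n + 1)) : X → Type)) y →L[ℝ]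
      (TangentSpace (𝓡 m) : Y → Type) y)

/-- The model with corners of `PreJetBundle`. -/
abbrev preJetModel (n m : ℕ) := (𝓡 m).prod 𝓘(ℝ, Coord (n + 1) →L[ℝ] Coord m)

variable {pr}

/-- `γ` is an element of `J¹_y Y`, i.e. `T_yπ ∘ γ` is the identity of `T_{π(y)}X`. -/
def IsJet {y : Y} (γ : PreJet pr y) : Prop :=
  (mfderiv (𝓡 m) (𝓡 (n + 1)) pr y).comp γ = ContinuousLinearMap.id ℝ _

variable (pr) in
/-- The jet bundle `J¹Y` as a submanifold of `Hom(π^*TX, TY)`. -/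
def JetSet : Set (PreJetBundle pr) := {p | IsJet (pr := pr) (y := p.1) p.2}

variable (pr) in
/-- A smooth Lagrangian density `ℒ : J¹Y → Λⁿ⁺¹X`, a map over `X`.  (Only its values on `J¹Y` are
meaningful.) -/
structure LagrangianDensity where
  toFun : ∀ y : Y, PreJet pr y → Form (d := n + 1) (n + 1) (pr y)
  smooth : ContMDiffOn (preJetModel n m) (formModel (n + 1) (n + 1)) ∞
    (fun p : PreJetBundle pr => (⟨pr p.1, toFun p.1 p.2⟩ : FormBundle (n + 1) X (n + 1)))
    (JetSet pr)

/-- `z ∈ Z_y ⊂ Λⁿ⁺¹ T_y^* Y`: one has `𝐢_v 𝐢_w z = 0` for all vertical `v`, `w`. -/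
def IsMultimomentum (pr : C^∞⟮𝓡 m, Y; 𝓡 (n + 1), X⟯) {y : Y} (z : Form (d := m) (n + 1) y) : Prop :=
  ∀ u : Fin (n + 1) → TangentSpace (𝓡 m) y,
    (∃ i j, i ≠ j ∧ u i ∈ Vertical pr y ∧ u j ∈ Vertical pr y) → z u = (0 : ℝ)

/-- `z = 𝔽ℒ(γ)`: the covariant Legendre transform of `γ ∈ J¹_y Y` is the `z ∈ Z_y` which, as an
affine map `γ' ↦ γ'^* z` from `J¹_y Y` to `Λⁿ⁺¹X`, is the first order vertical Taylor approximation
`γ' ↦ ℒ(γ) + d/dε|₀ ℒ(γ + ε (γ' - γ))` of `ℒ` at `γ`. -/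
def IsLegendre (L : LagrangianDensity pr) {y : Y} (γ : PreJet pr y)
    (z : Form (d := m) (n + 1) y) : Prop :=
  IsMultimomentum pr z ∧
    ∀ γ' : PreJet pr y, IsJet γ' → ∀ u : Fin (n + 1) → TangentSpace (𝓡 (n + 1)) (pr y),
      (show ℝ from z (fun i => γ' (u i))) =
        (show ℝ from L.toFun y γ u) +
          deriv (fun ε : ℝ => (show ℝ from L.toFun y (γ + ε • (γ' - γ)) u)) 0

/-- An infinitesimal action of `𝔤` on the bundle `Y → X`: the infinitesimal generators `ξ_Y` of a
group acting by bundle automorphisms.  They are smooth vector fields on `Y`, projectable to smooth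
vector fields on `X`, and depend linearly on `ξ ∈ 𝔤`. -/
structure BundleAction (𝔤 : Type*) [AddCommGroup 𝔤] [Module ℝ 𝔤]
    (pr : C^∞⟮𝓡 m, Y; 𝓡 (n + 1), X⟯) where
  gen : 𝔤 →ₗ[ℝ] (∀ y : Y, TangentSpace (𝓡 m) y)
  smooth : ∀ ξ, ContMDiff (𝓡 m) (𝓡 m).tangent ∞
    (fun y : Y => (⟨y, gen ξ y⟩ : TangentBundle (𝓡 m) Y))
  projectable : ∀ ξ, ∃ ξX : ∀ x : X, TangentSpace (𝓡 (n + 1)) x,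
    ContMDiff (𝓡 (n + 1)) (𝓡 (n + 1)).tangent ∞
      (fun x : X => (⟨x, ξX x⟩ : TangentBundle (𝓡 (n + 1)) X)) ∧
    ∀ y, mfderiv (𝓡 m) (𝓡 (n + 1)) pr y (gen ξ y) = ξX (pr y)

end Covariant

/-! ### The instantaneous theory on a Cauchy surface `Σ_τ = τ(S)`

All objects over `Σ_τ` are regarded as objects over `S` by means of the embedding `τ`. -/

section Instantaneous

variable {n m : ℕ} {X Y S : Type*}
  [TopologicalSpace X] [ChartedSpace (Coord (n + 1)) X] [IsManifold (𝓡 (n + 1)) ∞ X]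
  [TopologicalSpace Y] [ChartedSpace (Coord m) Y] [IsManifold (𝓡 m) ∞ Y]
  [TopologicalSpace S] [ChartedSpace (Coord n) S] [IsManifold (𝓡 n) ∞ S]
  (pr : C^∞⟮𝓡 m, Y; 𝓡 (n + 1), X⟯) (τ : S → X)

/-- The `τ`-configuration space `𝒴_τ`: the smooth sections of `Y` over `Σ_τ`. -/
structure Config where
  toFun : S → Y
  smooth : ContMDiff (𝓡 n) (𝓡 m) ∞ toFun
  covers : ∀ x, pr (toFun x) = τ x

variable {pr τ}

/-- The derivative `T_x φ : T_x Σ_τ → T_{φ(x)} Y`. -/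
abbrev Config.deriv (φ : Config pr τ) (x : S) :
    TangentSpace (𝓡 n) x →L[ℝ] TangentSpace (𝓡 m) (φ.toFun x) :=
  mfderiv (𝓡 n) (𝓡 m) φ.toFun x

/-- The derivative of the embedding `τ = π ∘ φ`, as a map `T_x Σ_τ → T_{π(φ(x))} X`. -/
abbrev Config.baseDeriv (φ : Config pr τ) (x : S) :
    TangentSpace (𝓡 n) x →L[ℝ] TangentSpace (𝓡 (n + 1)) (pr (φ.toFun x)) :=
  mfderiv (𝓡 n) (𝓡 (n + 1)) (fun x' => pr (φ.toFun x')) x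

/-- The tangent space `T_φ 𝒴_τ`: the smooth vertical vector fields along `φ`. -/
structure Velocity (φ : Config pr τ) where
  toFun : ∀ x, TangentSpace (𝓡 m) (φ.toFun x)
  vertical : ∀ x, toFun x ∈ Vertical pr (φ.toFun x)
  smooth : ContMDiff (𝓡 n) (𝓡 m).tangent ∞
    (fun x => (⟨φ.toFun x, toFun x⟩ : TangentBundle (𝓡 m) Y))

variable (pr τ) in
/-- The `τ`-phase space `T^*𝒴_τ`: its points are the pairs `(φ, π)` of `φ ∈ 𝒴_τ` and a smooth
section `π` of `L(VY_τ, ΛⁿΣ_τ)` along `φ`. -/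
structure Phase where
  field : Config pr τ
  mom : ∀ x : S, Vertical pr (field.toFun x) →ₗ[ℝ] Form (d := n) n x
  smooth : ∀ V : Velocity field, ContMDiff (𝓡 n) (formModel n n) ∞
    (fun x => (⟨x, mom x ⟨V.toFun x, V.vertical x⟩⟩ : FormBundle n S n))

variable (pr τ) in
/-- An infinitesimal slicing of `Y`: a vector field `ζ_Y` on `Y` defined over `Y_τ`, which projects
to a vector field `ζ_X` on `X`, defined over and transverse to `Σ_τ`.  (Only the values of `ζ_Y`
over `Y_τ` and those of `ζ_X` over `Σ_τ` are meaningful.) -/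
structure InfSlicing where
  onX : ∀ p : X, TangentSpace (𝓡 (n + 1)) p
  onY : ∀ y : Y, TangentSpace (𝓡 m) y
  smooth_onX : ContMDiff (𝓡 n) (𝓡 (n + 1)).tangent ∞
    (fun x : S => (⟨τ x, onX (τ x)⟩ : TangentBundle (𝓡 (n + 1)) X))
  smooth_onY : ContMDiffOn (𝓡 m) (𝓡 m).tangent ∞
    (fun y : Y => (⟨y, onY y⟩ : TangentBundle (𝓡 m) Y)) (pr ⁻¹' Set.range τ)
  projects : ∀ y, pr y ∈ Set.range τ → mfderiv (𝓡 m) (𝓡 (n + 1)) pr y (onY y) = onX (pr y)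
  transverse : ∀ x : S, onX (τ x) ∉ Set.range (mfderiv (𝓡 n) (𝓡 (n + 1)) τ x)

/-- The jet reconstruction map: the jet `γ ∈ J¹Y` at `φ(x)` with `γ ∘ T_xτ = T_xφ` and
`γ(ζ_X) - ζ_Y = v`, that is, `γ = (T_xφ ⊕ (v + ζ_Y)) ∘ (T_xτ ⊕ ζ_X)⁻¹`. -/
def reconstruct (ζ : InfSlicing pr τ) (φ : Config pr τ) (x : S)
    (v : TangentSpace (𝓡 m) (φ.toFun x)) : PreJet pr (φ.toFun x) :=
  ((φ.deriv x).coprod (ContinuousLinearMap.toSpanSingleton ℝ (v + ζ.onY (φ.toFun x)))).comp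
    ((φ.baseDeriv x).coprod
      (ContinuousLinearMap.toSpanSingleton ℝ (ζ.onX (pr (φ.toFun x))))).inverse

/-- The density `ℒ_{τ,ζ}(j¹φ(x), v) = i_τ^* 𝐢_{ζ_X} ℒ(γ)` of the instantaneous Lagrangian,
where `γ` is the reconstruction of `(j¹φ(x), v)`. -/
def instLagrangian (L : LagrangianDensity pr) (ζ : InfSlicing pr τ) (φ : Config pr τ) (x : S)
    (v : TangentSpace (𝓡 m) (φ.toFun x)) : Form (d := n) n x :=
  ContinuousAlternatingMap.compContinuousLinearMap
    (interiorProduct (E := Coord (n + 1)) (ζ.onX (pr (φ.toFun x)))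
      (L.toFun (φ.toFun x) (reconstruct ζ φ x v)))
    (φ.baseDeriv x)

/-- The fibre derivative of `ℒ_{τ,ζ}(j¹φ(x), ·)` at `v` in the direction `w`, evaluated on tangent
vectors `u` of `Σ_τ`: in adapted coordinates this is `∂ℒ_{τ,ζ}/∂ẏ^A wᴬ`. -/
def instMomentum (L : LagrangianDensity pr) (ζ : InfSlicing pr τ) (φ : Config pr τ) (x : S)
    (v w : TangentSpace (𝓡 m) (φ.toFun x)) (u : Fin n → TangentSpace (𝓡 n) x) : ℝ :=
  _root_.deriv (fun ε : ℝ => (show ℝ from instLagrangian L ζ φ x (v + ε • w) u)) 0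

/-- `(φ, π) = 𝔽L_{τ,ζ}(φ, φ̇)`: the instantaneous Legendre transform. -/
def IsInstLegendre (L : LagrangianDensity pr) (ζ : InfSlicing pr τ) (P : Phase pr τ)
    (v : Velocity P.field) : Prop :=
  ∀ (x : S) (w : Vertical pr (P.field.toFun x)) (u : Fin n → TangentSpace (𝓡 n) x),
    (show ℝ from P.mom x w u) = instMomentum L ζ P.field x (v.toFun x) w u

/-- The `τ`-primary constraint set `𝒫_τ ⊂ T^*𝒴_τ`, the image of `𝔽L_{τ,ζ}`. -/
def primaryConstraintSet (L : LagrangianDensity pr) (ζ : InfSlicing pr τ) : Set (Phase pr τ) :=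
  {P | ∃ v : Velocity P.field, IsInstLegendre L ζ P v}

/-- The fibres of `𝔽L_{τ,ζ} : T𝒴_τ → T^*𝒴_τ` are connected: any two points `(φ, v₀)`, `(φ, v₁)` of
a fibre are joined by a smooth curve in the fibre.  A curve `s ↦ v_s` in the space of sections
`T_φ𝒴_τ` is smooth if `(s, x) ↦ v_s(x)` is. -/
def HasConnectedFibres (L : LagrangianDensity pr) (ζ : InfSlicing pr τ) : Prop :=
  ∀ (P : Phase pr τ) (v₀ v₁ : Velocity P.field),
    IsInstLegendre L ζ P v₀ → IsInstLegendre L ζ P v₁ →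
    ∃ c : ℝ → Velocity P.field,
      ContMDiff (𝓘(ℝ, ℝ).prod (𝓡 n)) (𝓡 m).tangent ∞
        (fun q : ℝ × S =>
          (⟨P.field.toFun q.2, (c q.1).toFun q.2⟩ : TangentBundle (𝓡 m) Y)) ∧
      c 0 = v₀ ∧ c 1 = v₁ ∧ ∀ s ∈ Set.Icc (0 : ℝ) 1, IsInstLegendre L ζ P (c s)

/-- The fibres of the instantaneous Legendre transform are connected pointwise: for each `φ ∈ 𝒴_τ`
and `x ∈ Σ_τ`, any two points of a fibre of the fibre derivative
`V_{φ(x)}Y → L(V_{φ(x)}Y, Λⁿ_xΣ_τ)` of `ℒ_{τ,ζ}(j¹φ(x), ·)` are joined by a smooth curve in that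
fibre. -/
def HasConnectedFibresPointwise (L : LagrangianDensity pr) (ζ : InfSlicing pr τ) : Prop :=
  ∀ (φ : Config pr τ) (x : S) (v₀ v₁ : TangentSpace (𝓡 m) (φ.toFun x)),
    v₀ ∈ Vertical pr (φ.toFun x) → v₁ ∈ Vertical pr (φ.toFun x) →
    (∀ w ∈ Vertical pr (φ.toFun x), ∀ u,
      instMomentum L ζ φ x v₀ w u = instMomentum L ζ φ x v₁ w u) →
    ∃ c : ℝ → Coord m, ContDiff ℝ ∞ c ∧ c 0 = v₀ ∧ c 1 = v₁ ∧
      ∀ s ∈ Set.Icc (0 : ℝ) 1, c s ∈ Vertical pr (φ.toFun x) ∧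
        ∀ w ∈ Vertical pr (φ.toFun x), ∀ u,
          instMomentum L ζ φ x (c s) w u = instMomentum L ζ φ x v₀ w u

/-- An element of `(j¹𝒴)_τ` over `φ`: a smooth field of `1`-jets of sections of `Y` along `Σ_τ` which
is holonomic, i.e. whose restriction to `TΣ_τ` is `Tφ`.  These are the restrictions to `Σ_τ` of the
`1`-jets of the sections `ϕ` of `Y` near `Σ_τ` that extend `φ`. -/
structure HolonomicJet (φ : Config pr τ) where
  toFun : ∀ x, PreJet pr (φ.toFun x)
  isJet : ∀ x, IsJet (toFun x)
  smooth : ContMDiff (𝓡 n) (preJetModel n m) ∞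
    (fun x => (⟨φ.toFun x, toFun x⟩ : PreJetBundle pr))
  holonomic : ∀ x, (toFun x).comp (φ.baseDeriv x) = φ.deriv x

/-- An element `σ` of `𝒵_τ` over `φ = π_{YZ} ∘ σ`: a smooth section of `Z` over `Σ_τ`. -/
structure MultimomentumField (φ : Config pr τ) where
  toFun : ∀ x, Form (d := m) (n + 1) (φ.toFun x)
  mem_Z : ∀ x, IsMultimomentum pr (toFun x)
  smooth : ContMDiff (𝓡 n) (formModel m (n + 1)) ∞
    (fun x => (⟨φ.toFun x, toFun x⟩ : FormBundle m Y (n + 1)))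

/-- `σ` as a map `Σ_τ → Z ⊂ Λⁿ⁺¹T^*Y`. -/
def MultimomentumField.toMap {φ : Config pr τ} (σ : MultimomentumField φ) (x : S) :
    FormBundle m Y (n + 1) := ⟨φ.toFun x, σ.toFun x⟩

/-- `σ` is a holonomic lift of `(φ, π)`: it lies in `R_τ⁻¹{(φ, π)} ∩ 𝒩_τ`, where
`𝒩_τ = 𝔽ℒ((j¹𝒴)_τ)` and `⟨R_τ(σ)(x), v⟩ = φ^* 𝐢_v σ(x)` for vertical `v`. -/
def IsHolonomicLift (L : LagrangianDensity pr) (P : Phase pr τ)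
    (σ : MultimomentumField P.field) : Prop :=
  (∃ γ : HolonomicJet P.field, ∀ x, IsLegendre L (γ.toFun x) (σ.toFun x)) ∧
    ∀ (x : S) (v : Vertical pr (P.field.toFun x)),
      ContinuousAlternatingMap.compContinuousLinearMap
        (interiorProduct (E := Coord m) (v : TangentSpace (𝓡 m) (P.field.toFun x)) (σ.toFun x))
        (P.field.deriv x) = P.mom x v

/-- The energy-momentum density `⟨𝔈_τ(σ), ξ⟩ = σ^*(𝐢_{ξ_Z} Θ)`, an `n`-form on `Σ_τ`.  Here `Θ` and
the canonical lift `ξ_Z` of `ξ_Y` are (the restrictions to `Z` of) the corresponding objects on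
`Λⁿ⁺¹T^*Y`. -/
def energyMomentumDensity {𝔤 : Type*} [AddCommGroup 𝔤] [Module ℝ 𝔤] (A : BundleAction 𝔤 pr)
    {φ : Config pr τ} (σ : MultimomentumField φ) (ξ : 𝔤) (x : S) : Form (d := n) n x :=
  ContinuousAlternatingMap.compContinuousLinearMap
    (interiorProduct (E := Coord m × (Coord m [⋀^Fin (n + 1)]→L[ℝ] ℝ))
      (canonicalLift (A.gen ξ) (σ.toMap x)) (canonicalForm (σ.toMap x)))
    (mfderiv (𝓡 n) (formModel m (n + 1)) σ.toMap x)

end Instantaneous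

end ClassicalFields

end

/-! Since `Θ` is a pullback along the bundle projection and `ξ_Z` projects to `ξ_Y`, the density
`σ^*(𝐢_{ξ_Z} Θ)(u₁, …, uₙ)` is `σ(ξ_Y, Tφ u₁, …, Tφ uₙ)` (`energyMomentumDensity_apply`). A lift
therefore enters only through the linear forms `M = σ(·, Tφ u)` on `T_{φ(x)}Y`.

Let `σ = 𝔽ℒ(γ)` with `γ` holonomic, and let `v = γ(ζ_X) - ζ_Y` be its velocity. As `τ` is an
immersion and `ζ_X` is transverse, `T_{φ(x)}Y` is spanned by the image of `Tφ`, the vector `γ(ζ_X)`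
and the vertical vectors. On the first `M` vanishes, because `n + 1` vectors from an image of `ℝⁿ`
are dependent. On `γ(ζ_X)` it is `ℒ(γ)(ζ_X, Tτ u)`, by the Legendre formula at `γ' = γ`. On vertical
vectors it is `π(u)`. For two lifts of `(φ, π)`, with velocities `v`, `v'`, the forms `M` and `M'`
thus coincide as soon as `ℒ_{τ,ζ}(v') - ℒ_{τ,ζ}(v) = ⟨π, v' - v⟩`; that is, the energy `⟨π, v⟩ -
ℒ_{τ,ζ}(v)` must be constant on the fibre of the fibre derivative. It is: along a curve `c` in the
fibre, `ℒ_{τ,ζ}(c) - ⟨π, c⟩` has derivative `⟨𝔽L(c) - π, ċ⟩ = 0` (`lagrangian_sub_eq`,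
`IsSplit.slot_eq_slot`). Both velocities lie in the fibre over `(φ, π)` by
`contract_eq_instMomentum`. Under (A) a curve of sections is evaluated at `x`; under (B) the curve
is given at `x`, so only `j¹φ(x)` and `π(x)` matter.

A lift is obtained by reconstructing a jet field from a velocity and applying `𝔽ℒ`. With `ℒ = l·vol`
and `D` the vertical derivative of `l`, the transform is `l T^*vol` plus the derivative of `A ↦
A^*vol` at `A = T`, the projection, in a direction `Q` dual to `D` (`legendreForm`). A formula in an
arbitrary frame, free of `vol`, gives its smoothness (`contMDiffAt_legendre`). -/

set_option linter.unusedSectionVars false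

noncomputable section

namespace ClassicalFields

/-! ### Tangent vectors and forms in local coordinates -/

section Coordinates

variable {d : ℕ} {M : Type*} [TopologicalSpace M] [ChartedSpace (Coord d) M]
  [IsManifold (𝓡 d) ∞ M]

/-- The components, in the preferred chart at `p₀`, of a tangent vector at `p`. -/
def toC (p₀ p : M) : TangentSpace (𝓡 d) p →L[ℝ] Coord d :=
  (trivializationAt (Coord d) (TangentSpace (𝓡 d) : M → Type) p₀).continuousLinearMapAt ℝ p

/-- The tangent vector at `p` with given components in the preferred chart at `p₀`. -/
def ofC (p₀ p : M) : Coord d →L[ℝ] TangentSpace (𝓡 d) p :=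
  (trivializationAt (Coord d) (TangentSpace (𝓡 d) : M → Type) p₀).symmL ℝ p

/-- The domain of the preferred chart at `p₀`, as the base set of a trivialization of the tangent
bundle. -/
abbrev chartDom (p₀ : M) : Set M :=
  (trivializationAt (Coord d) (TangentSpace (𝓡 d) : M → Type) p₀).baseSet

theorem mem_chartDom (p₀ : M) : p₀ ∈ chartDom (d := d) p₀ :=
  mem_baseSet_trivializationAt _ _ _

theorem toC_ofC {p₀ p : M} (hp : p ∈ chartDom (d := d) p₀) (v : Coord d) :
    toC (d := d) p₀ p (ofC p₀ p v) = v :=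
  Trivialization.continuousLinearMapAt_symmL _ hp v

theorem ofC_toC {p₀ p : M} (hp : p ∈ chartDom (d := d) p₀) (v : TangentSpace (𝓡 d) p) :
    ofC (d := d) p₀ p (toC p₀ p v) = v :=
  Trivialization.symmL_continuousLinearMapAt _ hp v

/-- The coordinates of tangent vectors, as a linear equivalence. -/
def coordEquiv {p₀ p : M} (hp : p ∈ chartDom (d := d) p₀) :
    TangentSpace (𝓡 d) p ≃L[ℝ] Coord d :=
  ContinuousLinearEquiv.equivOfInverse (toC p₀ p) (ofC p₀ p) (ofC_toC hp) (toC_ofC hp)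

theorem eventually_mem_chartDom {N : Type*} [TopologicalSpace N] {f : N → M} {x₀ : N}
    (hf : ContinuousAt f x₀) : ∀ᶠ x in 𝓝 x₀, f x ∈ chartDom (d := d) (f x₀) :=
  hf ((Trivialization.open_baseSet _).mem_nhds (mem_chartDom (f x₀)))

variable {E' H' N : Type*} [NormedAddCommGroup E'] [NormedSpace ℝ E'] [TopologicalSpace H']
  {I : ModelWithCorners ℝ E' H'} [TopologicalSpace N] [ChartedSpace H' N]

/-- `toC` is zero off the chart domain, but smoothness at `x₀` only sees a neighbourhood, where it
agrees with the trivialization. The criteria for forms and jets rest on the same remark. -/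
theorem contMDiffAt_tangent_iff {f : N → M} {s : ∀ x, TangentSpace (𝓡 d) (f x)} {x₀ : N} :
    ContMDiffAt I (𝓡 d).tangent ∞ (fun x => (⟨f x, s x⟩ : TangentBundle (𝓡 d) M)) x₀ ↔
      ContMDiffAt I (𝓡 d) ∞ f x₀ ∧
        ContMDiffAt I 𝓘(ℝ, Coord d) ∞ (fun x => toC (f x₀) (f x) (s x)) x₀ := by
  refine contMDiffAt_totalSpace.trans (and_congr_right fun hf => ?_)
  refine Filter.EventuallyEq.contMDiffAt_iff ?_
  filter_upwards [eventually_mem_chartDom (d := d) hf.continuousAt] with x hx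
  exact (congrFun (Trivialization.coe_linearMapAt_of_mem _ hx) (s x)).symm

theorem contMDiffAt_form_iff_comp {k : ℕ} {f : N → M} {s : ∀ x, Form (d := d) k (f x)} {x₀ : N} :
    ContMDiffAt I (formModel d k) ∞ (fun x => (⟨f x, s x⟩ : FormBundle d M k)) x₀ ↔
      ContMDiffAt I (𝓡 d) ∞ f x₀ ∧
        ContMDiffAt I 𝓘(ℝ, Coord d [⋀^Fin k]→L[ℝ] ℝ) ∞
          (fun x => (show Coord d [⋀^Fin k]→L[ℝ] ℝ from
            (s x).compContinuousLinearMap (ofC (f x₀) (f x)))) x₀ := by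
  refine contMDiffAt_totalSpace.trans (and_congr_right fun hf => ?_)
  refine Filter.EventuallyEq.contMDiffAt_iff ?_
  filter_upwards [eventually_mem_chartDom (d := d) hf.continuousAt] with x hx
  rw [FiberBundle.trivializationAt_continuousAlternatingMap_apply]
  ext u
  simp only [ContinuousAlternatingMap.inCoordinates]
  erw [ContinuousAlternatingMap.compContinuousLinearMap_apply]
  exact congrArg (fun g : ℝ →L[ℝ] ℝ => g (s x (ofC (f x₀) (f x) ∘ u)))
    (Bundle.Trivial.continuousLinearMapAt_trivialization ℝ M ℝ (f x))

/-- Alternating forms on a coordinate space depend smoothly on a parameter if their values do. -/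
theorem contMDiffAt_alternating_iff {k : ℕ} {α : N → Coord d [⋀^Fin k]→L[ℝ] ℝ} {x₀ : N} :
    ContMDiffAt I 𝓘(ℝ, Coord d [⋀^Fin k]→L[ℝ] ℝ) ∞ α x₀ ↔
      ∀ u : Fin k → Coord d, ContMDiffAt I 𝓘(ℝ, ℝ) ∞ (fun x => α x u) x₀ := by
  constructor
  · intro h u
    exact ((ContinuousAlternatingMap.apply ℝ (Coord d) ℝ u).contMDiff.contMDiffAt).comp x₀ h
  · intro h
    let b := (EuclideanSpace.basisFun (Fin d) ℝ).toBasis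
    -- Values on tuples of basis vectors determine a form, so `Φ` has a linear left inverse,
    -- continuous because its domain is finite-dimensional; smoothness is transported through it.
    let Φ : (Coord d [⋀^Fin k]→L[ℝ] ℝ) →ₗ[ℝ] ((Fin k → Fin d) → ℝ) :=
      { toFun := fun A r => A (fun i => b (r i))
        map_add' := fun _ _ => rfl
        map_smul' := fun _ _ => rfl }
    have hΦ : LinearMap.ker Φ = ⊥ := by
      refine LinearMap.ker_eq_bot'.2 fun A hA => ?_
      apply ContinuousAlternatingMap.toAlternatingMap_injective
      refine Module.Basis.ext_alternating b fun v _ => ?_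
      exact congrFun hA v
    obtain ⟨Ψ, hΨ⟩ := Φ.exists_leftInverse_of_injective hΦ
    have h1 : ContMDiffAt I 𝓘(ℝ, (Fin k → Fin d) → ℝ) ∞ (fun x => Φ (α x)) x₀ :=
      contMDiffAt_pi_space.2 fun r => h fun i => b (r i)
    have h2 := (LinearMap.toContinuousLinearMap Ψ).contMDiff.contMDiffAt.comp x₀ h1
    refine h2.congr_of_eventuallyEq (Filter.Eventually.of_forall fun x => ?_)
    exact (LinearMap.congr_fun hΨ (α x)).symm

theorem contMDiffAt_form_iff {k : ℕ} {f : N → M} {s : ∀ x, Form (d := d) k (f x)} {x₀ : N} :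
    ContMDiffAt I (formModel d k) ∞ (fun x => (⟨f x, s x⟩ : FormBundle d M k)) x₀ ↔
      ContMDiffAt I (𝓡 d) ∞ f x₀ ∧ ∀ u : Fin k → Coord d,
        ContMDiffAt I 𝓘(ℝ, ℝ) ∞
          (fun x => (show ℝ from s x fun i => ofC (f x₀) (f x) (u i))) x₀ :=
  contMDiffAt_form_iff_comp.trans (and_congr_right fun _ => contMDiffAt_alternating_iff)

/-- The values of a smooth form along a map on vectors with smooth components are smooth. -/
theorem contMDiffAt_form_apply {k : ℕ} {f : N → M} {s : ∀ x, Form (d := d) k (f x)} {x₀ : N}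
    (hs : ContMDiffAt I (formModel d k) ∞ (fun x => (⟨f x, s x⟩ : FormBundle d M k)) x₀)
    {w : ∀ x, Fin k → TangentSpace (𝓡 d) (f x)}
    (hw : ∀ i, ContMDiffAt I 𝓘(ℝ, Coord d) ∞ (fun x => toC (f x₀) (f x) (w x i)) x₀) :
    ContMDiffAt I 𝓘(ℝ, ℝ) ∞ (fun x => (show ℝ from s x (w x))) x₀ := by
  have h1 := contMDiffAt_form_iff_comp.1 hs
  have h2 : ContMDiffAt I 𝓘(ℝ, Fin k → Coord d) ∞
      (fun x i => toC (f x₀) (f x) (w x i)) x₀ := contMDiffAt_pi_space.2 hw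
  -- Evaluation is linear in the form and multilinear in the vectors, hence analytic in both
  -- jointly.
  have h3 : ContDiff ℝ ∞ (fun p : (Coord d [⋀^Fin k]→L[ℝ] ℝ) × (Fin k → Coord d) => p.1 p.2) := by
    have := (ContinuousLinearMap.analyticOnNhd_uncurry_of_multilinear (s := Set.univ)
      (ContinuousAlternatingMap.toContinuousMultilinearMapCLM  ℝ :
        (Coord d [⋀^Fin k]→L[ℝ] ℝ) →L[ℝ] _)).contDiff (n := ∞)
    exact this
  have h4 := h3.contMDiff.contMDiffAt.comp x₀ (h1.2.prodMk_space h2)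
  refine h4.congr_of_eventuallyEq ?_
  filter_upwards [eventually_mem_chartDom (d := d) h1.1.continuousAt] with x hx
  simp only [Function.comp]
  erw [ContinuousAlternatingMap.compContinuousLinearMap_apply]
  congr 1
  ext i : 1
  exact (ofC_toC hx _).symm

variable {d' : ℕ} {M' : Type*} [TopologicalSpace M'] [ChartedSpace (Coord d') M']
  [IsManifold (𝓡 d') ∞ M']

theorem contMDiffAt_mfderiv_coord {f : M → M'} {p₀ : M}
    (hf : ContMDiffAt (𝓡 d) (𝓡 d') ∞ f p₀) :
    ContMDiffAt (𝓡 d) 𝓘(ℝ, Coord d →L[ℝ] Coord d') ∞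
      (fun p => (toC (f p₀) (f p)).comp ((mfderiv (𝓡 d) (𝓡 d') f p).comp (ofC p₀ p))) p₀ :=
  hf.mfderiv_const (m := ∞) (by simp)

end Coordinates

/-! ### Smoothness of jet fields in coordinates. -/

section PreJets

variable {n m : ℕ} {X Y : Type*}
  [TopologicalSpace X] [ChartedSpace (Coord (n + 1)) X] [IsManifold (𝓡 (n + 1)) ∞ X]
  [TopologicalSpace Y] [ChartedSpace (Coord m) Y] [IsManifold (𝓡 m) ∞ Y]
  {pr : C^∞⟮𝓡 m, Y; 𝓡 (n + 1), X⟯}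
  {E' H' N : Type*} [NormedAddCommGroup E'] [NormedSpace ℝ E'] [TopologicalSpace H']
  {I : ModelWithCorners ℝ E' H'} [TopologicalSpace N] [ChartedSpace H' N]

theorem contMDiffAt_preJet_iff {f : N → Y} {g : ∀ x, PreJet pr (f x)} {x₀ : N} :
    ContMDiffAt I (preJetModel n m) ∞ (fun x => (⟨f x, g x⟩ : PreJetBundle pr)) x₀ ↔
      ContMDiffAt I (𝓡 m) ∞ f x₀ ∧
        ContMDiffAt I 𝓘(ℝ, Coord (n + 1) →L[ℝ] Coord m) ∞
          (fun x => (toC (f x₀) (f x)).comp ((g x).comp (ofC (pr (f x₀)) (pr (f x))))) x₀ := by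
  refine (contMDiffAt_hom_bundle _).trans (and_congr_right fun hf => ?_)
  refine Filter.EventuallyEq.contMDiffAt_iff ?_
  have hp : ContinuousAt (fun x => pr (f x)) x₀ :=
    pr.contMDiff.continuous.continuousAt.comp hf.continuousAt
  filter_upwards [eventually_mem_chartDom (d := m) hf.continuousAt,
    eventually_mem_chartDom (d := n + 1) hp] with x hx hx'
  ext1 v
  -- The pullback bundle is trivialized by the chart of `X` at `π(f x₀)`; applying that chart to
  -- both inverses identifies them.
  have h : (trivializationAt (Coord (n + 1))
      ((pr : Y → X) *ᵖ (TangentSpace (𝓡 (n + 1)) : X → Type)) (f x₀)).symmL ℝ (f x) v =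
      ofC (pr (f x₀)) (pr (f x)) v := by
    let e := trivializationAt (Coord (n + 1))
      ((pr : Y → X) *ᵖ (TangentSpace (𝓡 (n + 1)) : X → Type)) (f x₀)
    have hx'' : f x ∈ e.baseSet := hx'
    have h1 : (e ⟨f x, e.symmL ℝ (f x) v⟩).2 = v := by
      rw [e.symmL_apply hx'', e.apply_mk_symm hx'']
    have h2 : toC (pr (f x₀)) (pr (f x)) (e.symmL ℝ (f x) v) = v :=
      (congrFun (Trivialization.coe_linearMapAt_of_mem (R := ℝ)
        (trivializationAt (Coord (n + 1)) (TangentSpace (𝓡 (n + 1)) : X → Type) (pr (f x₀))) hx')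
          _).trans h1
    exact (ofC_toC hx' _).symm.trans (congrArg (ofC (pr (f x₀)) (pr (f x))) h2)
  exact congrArg (fun w => toC (f x₀) (f x) (g x w)) h

end PreJets

/-! ### Linear algebra of multimomenta -/

section LegendreForm

variable {n : ℕ} {E : Type*} [NormedAddCommGroup E] [NormedSpace ℝ E]

/-- The standard basis vectors of the coordinate space. -/
abbrev stdVec {k : ℕ} (j : Fin k) : Coord k := EuclideanSpace.single j (1 : ℝ)

theorem sum_smul_stdVec {k : ℕ} (w : Coord k) : ∑ j, w j • stdVec j = w := by
  ext i
  simp [Pi.single_apply]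

/-- The linear map `Q : E → F` representing a linear functional `D` on `Hom(F, E)`, composed with
the projection `1 - γT`, through the trace pairing. -/
def gradientMap (T : E →L[ℝ] Coord (n + 1)) (γ : Coord (n + 1) →L[ℝ] E)
    (D : (Coord (n + 1) →L[ℝ] E) →L[ℝ] ℝ) : E →L[ℝ] Coord (n + 1) :=
  ∑ j, (D ∘L ContinuousLinearMap.smulRightL ℝ (Coord (n + 1)) E
    (EuclideanSpace.proj j : Coord (n + 1) →L[ℝ] ℝ) ∘L
      (ContinuousLinearMap.id ℝ E - γ ∘L T)).smulRight (stdVec j)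

theorem gradientMap_apply (T : E →L[ℝ] Coord (n + 1)) (γ : Coord (n + 1) →L[ℝ] E)
    (D : (Coord (n + 1) →L[ℝ] E) →L[ℝ] ℝ) (u : E) :
    gradientMap T γ D u = ∑ j, D ((EuclideanSpace.proj j : Coord (n + 1) →L[ℝ] ℝ).smulRight
      (u - γ (T u))) • stdVec j := by
  simp only [gradientMap, sum_apply, ContinuousLinearMap.smulRight_apply]
  rfl

/-- This is the frame-independent characterization of `gradientMap`; it allows expansion in any
frame, not only the standard one. -/
theorem apply_gradientMap (T : E →L[ℝ] Coord (n + 1)) (γ : Coord (n + 1) →L[ℝ] E)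
    (D : (Coord (n + 1) →L[ℝ] E) →L[ℝ] ℝ) (u : E) (l : Coord (n + 1) →L[ℝ] ℝ) :
    l (gradientMap T γ D u) = D (l.smulRight (u - γ (T u))) := by
  rw [gradientMap_apply, map_sum]
  have : l.smulRight (u - γ (T u)) = ∑ j, l (stdVec j) •
      (EuclideanSpace.proj j : Coord (n + 1) →L[ℝ] ℝ).smulRight (u - γ (T u)) := by
    ext w : 1
    simp only [ContinuousLinearMap.smulRight_apply, sum_apply,
      smul_apply, smul_smul, ← Finset.sum_smul]
    congr 1
    conv_lhs => rw [← sum_smul_stdVec w, map_sum]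
    exact Finset.sum_congr rfl fun j _ => by simp [mul_comm]
  rw [this, map_sum]
  exact Finset.sum_congr rfl fun j _ => by simp [mul_comm]

/-- The multimomentum with value `l • vol` at the jet `γ` and vertical derivative `D • vol`. -/
def legendreForm (vol : Coord (n + 1) [⋀^Fin (n + 1)]→L[ℝ] ℝ) (T : E →L[ℝ] Coord (n + 1))
    (γ : Coord (n + 1) →L[ℝ] E) (l : ℝ) (D : (Coord (n + 1) →L[ℝ] E) →L[ℝ] ℝ) :
    E [⋀^Fin (n + 1)]→L[ℝ] ℝ :=
  l • vol.compContinuousLinearMap T + vol.fderivCompContinuousLinearMap T (gradientMap T γ D)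

variable (vol : Coord (n + 1) [⋀^Fin (n + 1)]→L[ℝ] ℝ) (T : E →L[ℝ] Coord (n + 1))
    (γ : Coord (n + 1) →L[ℝ] E) (l : ℝ) (D : (Coord (n + 1) →L[ℝ] E) →L[ℝ] ℝ)

/-- By the product rule, differentiating `A ↦ A^*vol` at `T` replaces `T` by the gradient map in one
slot at a time. -/
theorem legendreForm_apply (u : Fin (n + 1) → E) :
    legendreForm vol T γ l D u = l * vol (fun i => T (u i)) +
      ∑ i, vol (Function.update (fun i => T (u i)) i (gradientMap T γ D (u i))) := by
  simp only [legendreForm, ContinuousAlternatingMap.add_apply, ContinuousAlternatingMap.smul_apply,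
    ContinuousAlternatingMap.compContinuousLinearMap_apply, smul_eq_mul,
    ContinuousAlternatingMap.fderivCompContinuousLinearMap_apply]
  congr 1
  refine Finset.sum_congr rfl fun i _ => ?_
  congr 1
  ext1 j
  rcases eq_or_ne j i with rfl | h
  · simp
  · simp [Function.update_of_ne h]

/-- Each term alters a single slot, so one of the two vertical arguments still enters through `T`
and gives `0`. -/
theorem legendreForm_eq_zero {u : Fin (n + 1) → E} {i j : Fin (n + 1)} (hij : i ≠ j)
    (hi : T (u i) = 0) (hj : T (u j) = 0) : legendreForm vol T γ l D u = 0 := by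
  rw [legendreForm_apply, vol.map_coord_zero i hi, mul_zero, zero_add]
  refine Finset.sum_eq_zero fun k _ => ?_
  rcases eq_or_ne k i with rfl | h
  · exact vol.map_coord_zero j (by rw [Function.update_of_ne hij.symm]; exact hj)
  · exact vol.map_coord_zero i (by rw [Function.update_of_ne h.symm]; exact hi)

/-- Here `vol` occurs only multiplied by `l` or by a value of `D`. These products are a value and a
derivative of the Lagrangian density, so the auxiliary volume form can be eliminated while the frame
remains free. -/
theorem legendreForm_apply_frame (e : Coord (n + 1) ≃L[ℝ] Coord (n + 1)) (u : Fin (n + 1) → E) :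
    legendreForm vol T γ l D u = l * vol (fun i => T (u i)) +
      ∑ i, ∑ j, D (((EuclideanSpace.proj j : Coord (n + 1) →L[ℝ] ℝ) ∘L
        (e : Coord (n + 1) →L[ℝ] Coord (n + 1))).smulRight (u i - γ (T (u i)))) *
          vol (Function.update (fun i => T (u i)) i (e.symm (stdVec j))) := by
  rw [legendreForm_apply]
  congr 1
  refine Finset.sum_congr rfl fun i _ => ?_
  have h : gradientMap T γ D (u i) = ∑ j, D (((EuclideanSpace.proj j : Coord (n + 1) →L[ℝ] ℝ) ∘L
        (e : Coord (n + 1) →L[ℝ] Coord (n + 1))).smulRight (u i - γ (T (u i)))) •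
          e.symm (stdVec j) := by
    simp only [← apply_gradientMap, ← map_smul, ← map_sum]
    rw [eq_comm, e.symm_apply_eq]
    exact sum_smul_stdVec _
  rw [h]
  exact (vol.toAlternatingMap.map_update_sum _ _ _ _).trans
    (Finset.sum_congr rfl fun j _ => vol.toAlternatingMap.map_update_smul _ _ _ _)

theorem legendreForm_comp_jet
    {γ' : Coord (n + 1) →L[ℝ] E} (hγ' : T ∘L γ' = ContinuousLinearMap.id ℝ _)
    (u : Fin (n + 1) → Coord (n + 1)) :
    legendreForm vol T γ l D (fun i => γ' (u i)) = (l + D (γ' - γ)) * vol u := by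
  let b := (EuclideanSpace.basisFun (Fin (n + 1)) ℝ).toBasis
  have hb : ∀ j, b j = stdVec j := fun j => by simp [b]
  have hT : ∀ w, T (γ' w) = w := fun w => DFunLike.congr_fun hγ' w
  suffices h : ((legendreForm vol T γ l D).compContinuousLinearMap γ').toAlternatingMap =
      (l + D (γ' - γ)) • vol.toAlternatingMap from DFunLike.congr_fun h u
  -- Both sides are alternating of top degree, so permutations of the basis suffice. In slot `i`
  -- only the component of the gradient along `b (v i)` survives, since any other repeats an
  -- argument; the sum is a trace, equal to `D (γ' - γ)`.
  refine Module.Basis.ext_alternating b fun v hv => ?_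
  have hv' : Function.Bijective v := Finite.injective_iff_bijective.1 hv
  change legendreForm vol T γ l D (fun i => γ' (b (v i))) = (l + D (γ' - γ)) * vol (fun i => b (v i))
  have hD : D (γ' - γ) = ∑ i, D ((EuclideanSpace.proj (v i) : Coord (n + 1) →L[ℝ] ℝ).smulRight
      (γ' (b (v i)) - γ (b (v i)))) := by
    rw [← map_sum, Function.Bijective.sum_comp hv'
      (fun j => (EuclideanSpace.proj j : Coord (n + 1) →L[ℝ] ℝ).smulRight (γ' (b j) - γ (b j)))]
    congr 1
    ext w : 1
    conv_lhs => rw [← sum_smul_stdVec w, map_sum]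
    simp only [sum_apply, ContinuousLinearMap.smulRight_apply, map_smul, hb]
    rfl
  rw [legendreForm_apply, hD, add_mul, Finset.sum_mul]
  simp only [hT]
  congr 1
  refine Finset.sum_congr rfl fun i _ => ?_
  rw [gradientMap_apply]
  refine (vol.toAlternatingMap.map_update_sum _ _ _ _).trans ?_
  rw [Finset.sum_eq_single (v i)]
  · refine (vol.toAlternatingMap.map_update_smul _ _ _ _).trans ?_
    rw [hT, ← hb, smul_eq_mul]
    congr 1
    exact congrArg vol (Function.update_eq_self i fun i => b (v i))
  · intro j _ hj
    obtain ⟨i', rfl⟩ := hv'.2 j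
    have hne : i ≠ i' := fun h => hj (by rw [h])
    refine (vol.toAlternatingMap.map_update_smul _ _ _ _).trans ?_
    rw [vol.toAlternatingMap.map_eq_zero_of_eq _ _ hne, smul_zero]
    rw [Function.update_self, Function.update_of_ne hne.symm, hb]
  · simp

/-- A form of top degree is a multiple of the volume form. -/
theorem exists_volume : ∃ vol : Coord (n + 1) [⋀^Fin (n + 1)]→L[ℝ] ℝ,
    ∀ (A : Coord (n + 1) [⋀^Fin (n + 1)]→L[ℝ] ℝ) u, A u = A (fun i => stdVec i) * vol u := by
  let b := (EuclideanSpace.basisFun (Fin (n + 1)) ℝ).toBasis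
  refine ⟨{ b.det with cont := ?_ }, fun A u => ?_⟩
  · change Continuous fun u => b.det u
    simp only [Module.Basis.det_apply]
    refine Continuous.matrix_det (continuous_matrix fun i j => ?_)
    exact ((EuclideanSpace.proj i : Coord (n + 1) →L[ℝ] ℝ).continuous.comp (continuous_apply j))
  · have := DFunLike.congr_fun (A.toAlternatingMap.eq_smul_basis_det b) u
    have hb : (b : Fin (n + 1) → Coord (n + 1)) = fun i => stdVec i := by ext1 j; simp [b]
    rw [hb] at this
    exact this

end LegendreForm

/-! ### The covariant Legendre transform -/

section Raw

variable {n : ℕ} {E : Type*} [NormedAddCommGroup E] [NormedSpace ℝ E]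

/-- The map `δ ↦ g + (δ - gTδ)` is an affine retraction of all linear maps onto the right inverses
of `T`. Composing with it extends a density smooth only on jets to a function smooth on a whole
vector space. -/
theorem add_sub_comp_isRightInverse (T : E →L[ℝ] Coord (n + 1)) (g : Coord (n + 1) →L[ℝ] E)
    (hg : ∀ w, T (g w) = w) (δ : Coord (n + 1) →L[ℝ] E) (w : Coord (n + 1)) :
    T ((g + (δ - g ∘L T ∘L δ)) w) = w := by
  simp [hg]

/-- The three clauses are membership in `Z`, the Taylor formula defining `𝔽ℒ`, and a description of
`z` by values and directional derivatives of `Λ` alone, from which smooth dependence is read off. -/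
theorem exists_legendreForm (T : E →L[ℝ] Coord (n + 1)) (g : Coord (n + 1) →L[ℝ] E)
    (hg : ∀ w, T (g w) = w)
    (Λ : (Coord (n + 1) →L[ℝ] E) → Coord (n + 1) [⋀^Fin (n + 1)]→L[ℝ] ℝ)
    (hΛ : ∀ u, ContDiff ℝ ∞ fun δ : Coord (n + 1) →L[ℝ] E => Λ (g + (δ - g ∘L T ∘L δ)) u) :
    ∃ z : E [⋀^Fin (n + 1)]→L[ℝ] ℝ,
      (∀ u i j, i ≠ j → T (u i) = 0 → T (u j) = 0 → z u = 0) ∧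
      (∀ γ' : Coord (n + 1) →L[ℝ] E, (∀ w, T (γ' w) = w) → ∀ u : Fin (n + 1) → Coord (n + 1),
        z (fun i => γ' (u i)) = Λ g u + deriv (fun ε : ℝ => Λ (g + ε • (γ' - g)) u) 0) ∧
      ∀ (e : Coord (n + 1) ≃L[ℝ] Coord (n + 1)) (u : Fin (n + 1) → E),
        z u = Λ g (fun i => T (u i)) +
          ∑ i, ∑ j, deriv (fun ε : ℝ => Λ (g + ε • ((EuclideanSpace.proj j :
            Coord (n + 1) →L[ℝ] ℝ) ∘L (e : Coord (n + 1) →L[ℝ] Coord (n + 1))).smulRight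
                (u i - g (T (u i))))
            (Function.update (fun i => T (u i)) i (e.symm (stdVec j)))) 0 := by
  obtain ⟨vol, hvol⟩ := exists_volume (n := n)
  let l : (Coord (n + 1) →L[ℝ] E) → ℝ := fun δ => Λ δ (fun i => stdVec i)
  have hL : ∀ δ u, Λ δ u = l δ * vol u := fun δ u => hvol (Λ δ) u
  let H : (Coord (n + 1) →L[ℝ] E) → ℝ := fun δ => l (g + (δ - g ∘L T ∘L δ))
  have hH : ContDiff ℝ ∞ H := hΛ _
  let D := fderiv ℝ H 0
  have hD : ∀ (δ : Coord (n + 1) →L[ℝ] E), (∀ w, T (δ w) = 0) →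
      ∀ u, deriv (fun ε : ℝ => Λ (g + ε • δ) u) 0 = D δ * vol u := by
    intro δ hδ u
    -- On directions killed by `T` the retraction acts as `δ ↦ g + δ`, so derivatives of `Λ` along
    -- jets are derivatives of `H`.
    have h1 : (fun ε : ℝ => Λ (g + ε • δ) u) = fun ε : ℝ => H (ε • δ) * vol u := by
      ext ε
      rw [hL]
      have : g ∘L T ∘L (ε • δ) = 0 := by
        ext1 w
        simp [hδ]
      simp only [H, this, sub_zero]
    have h2 : HasDerivAt (fun ε : ℝ => ε • δ) δ 0 := by
      simpa using (hasDerivAt_id (0 : ℝ)).smul_const δ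
    have h3 : HasFDerivAt H D ((0 : ℝ) • δ) := by
      rw [zero_smul]
      exact (hH.differentiable (by simp) 0).hasFDerivAt
    rw [h1]
    exact ((h3.comp_hasDerivAt (0 : ℝ) h2).mul_const _).deriv
  refine ⟨legendreForm vol T g (l g) D, ?_, ?_, ?_⟩
  · intro u i j hij hi hj
    exact legendreForm_eq_zero vol T g (l g) D hij hi hj
  · intro γ' hγ' u
    rw [legendreForm_comp_jet vol T g (l g) D (ContinuousLinearMap.ext hγ') u, add_mul, hL g,
      hD (γ' - g) (fun w => by simp [hg, hγ'])]
  · intro e u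
    rw [legendreForm_apply_frame vol T g (l g) D e u, hL g]
    congr 1
    refine Finset.sum_congr rfl fun i _ => Finset.sum_congr rfl fun j _ => ?_
    rw [hD _ (fun w => by simp [hg])]

end Raw

section Legendre

variable {n m : ℕ} {X Y : Type*}
  [TopologicalSpace X] [ChartedSpace (Coord (n + 1)) X] [IsManifold (𝓡 (n + 1)) ∞ X]
  [TopologicalSpace Y] [ChartedSpace (Coord m) Y] [IsManifold (𝓡 m) ∞ Y]
  {pr : C^∞⟮𝓡 m, Y; 𝓡 (n + 1), X⟯}

section Param

variable {E' H' N : Type*} [NormedAddCommGroup E'] [NormedSpace ℝ E'] [TopologicalSpace H']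
  {I : ModelWithCorners ℝ E' H'} [TopologicalSpace N] [ChartedSpace H' N]

/-- The Lagrangian density is smooth along smooth families of jets. -/
theorem contMDiffAt_lagrangian (L : LagrangianDensity pr) {f : N → Y} {g : ∀ x, PreJet pr (f x)}
    (hg : ∀ x, IsJet (g x)) {x₀ : N}
    (h : ContMDiffAt I (preJetModel n m) ∞ (fun x => (⟨f x, g x⟩ : PreJetBundle pr)) x₀) :
    ContMDiffAt I (formModel (n + 1) (n + 1)) ∞
      (fun x => (⟨pr (f x), L.toFun (f x) (g x)⟩ : FormBundle (n + 1) X (n + 1))) x₀ := by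
  have h1 := (L.smooth ⟨f x₀, g x₀⟩ (hg x₀)).comp x₀ (contMDiffWithinAt_univ.2 h)
    (fun x _ => hg x)
  exact contMDiffWithinAt_univ.1 h1

end Param

theorem contDiff_lagrangian (L : LagrangianDensity pr) {W : Type*} [NormedAddCommGroup W]
    [NormedSpace ℝ W] (y : Y) (g : W → Coord (n + 1) →L[ℝ] Coord m) (hg : ContDiff ℝ ∞ g)
    (hj : ∀ w, IsJet (pr := pr) (y := y) (g w)) (u : Fin (n + 1) → Coord (n + 1)) :
    ContDiff ℝ ∞ (fun w => (show ℝ from L.toFun y (g w) u)) := by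
  rw [← contMDiff_iff_contDiff]
  intro w₀
  have h1 : ContMDiffAt 𝓘(ℝ, W) (preJetModel n m) ∞
      (fun w => (⟨y, g w⟩ : PreJetBundle pr)) w₀ := by
    refine contMDiffAt_preJet_iff.2 ⟨contMDiffAt_const, ?_⟩
    have : ContDiff ℝ ∞ (fun w => ((toC y y : Coord m →L[ℝ] Coord m)).comp ((g w).comp
      (ofC (pr y) (pr y) : Coord (n + 1) →L[ℝ] Coord (n + 1)))) :=
      contDiff_const.clm_comp (hg.clm_comp contDiff_const)
    exact this.contMDiff w₀
  have h2 := contMDiffAt_lagrangian (f := fun _ => y) L hj h1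
  exact contMDiffAt_form_apply (f := fun _ => pr y) (w := fun _ => u) h2
    (fun i => contMDiffAt_const)

theorem isJet_iff {y : Y} {γ : PreJet pr y} :
    IsJet γ ↔ ∀ w, mfderiv (𝓡 m) (𝓡 (n + 1)) pr y (γ w) = w :=
  DFunLike.ext_iff

theorem IsJet.add_smul {y : Y} {γ δ : PreJet pr y} (hγ : IsJet γ)
    (hδ : ∀ w, mfderiv (𝓡 m) (𝓡 (n + 1)) pr y (δ w) = 0) (ε : ℝ) : IsJet (γ + ε • δ) := by
  rw [isJet_iff] at hγ ⊢
  intro w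
  have h1 : (γ + ε • δ) w = γ w + ε • δ w := rfl
  rw [h1, map_add, map_smul, hγ, hδ, smul_zero, add_zero]

/-- The covariant Legendre transform of a jet exists.  The formula for its components in a frame
is used to show that it depends smoothly on the jet. -/
theorem exists_isLegendre (L : LagrangianDensity pr) {y : Y} {γ : PreJet pr y} (hγ : IsJet γ) :
    ∃ z : Form (d := m) (n + 1) y, IsLegendre L γ z ∧
      ∀ (e : TangentSpace (𝓡 (n + 1)) (pr y) ≃L[ℝ] Coord (n + 1))
        (u : Fin (n + 1) → TangentSpace (𝓡 m) y),
        (show ℝ from z u) =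
          (show ℝ from L.toFun y γ (fun i => mfderiv (𝓡 m) (𝓡 (n + 1)) pr y (u i))) +
          ∑ i, ∑ j, deriv (fun ε : ℝ => (show ℝ from L.toFun y
            (γ + ε • ((EuclideanSpace.proj j : Coord (n + 1) →L[ℝ] ℝ) ∘L
              (e : TangentSpace (𝓡 (n + 1)) (pr y) →L[ℝ] Coord (n + 1))).smulRight
                (u i - γ (mfderiv (𝓡 m) (𝓡 (n + 1)) pr y (u i))))
            (Function.update (fun i => mfderiv (𝓡 m) (𝓡 (n + 1)) pr y (u i)) i
              (e.symm (stdVec j))))) 0 := by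
  -- Tangent spaces unfold to coordinate spaces; the retyping supplies the normed structure used by
  -- the linear algebra.
  let T : Coord m →L[ℝ] Coord (n + 1) := mfderiv (𝓡 m) (𝓡 (n + 1)) pr y
  let g : Coord (n + 1) →L[ℝ] Coord m := γ
  have hg : ∀ w, T (g w) = w := isJet_iff.1 hγ
  obtain ⟨z, h1, h2, h3⟩ := exists_legendreForm T g hg (L.toFun y) fun u =>
    contDiff_lagrangian L y (fun δ => g + (δ - g ∘L T ∘L δ))
      (contDiff_const.add (contDiff_id.sub
        (contDiff_const.clm_comp (contDiff_const.clm_comp contDiff_id))))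
      (fun δ => isJet_iff.2 (add_sub_comp_isRightInverse T g hg δ)) u
  refine ⟨z, ⟨?_, fun γ' hγ' u => h2 γ' (isJet_iff.1 hγ') u⟩, fun e u => h3 e u⟩
  rintro u ⟨i, j, hij, hi, hj⟩
  exact h1 u i j hij hi hj

end Legendre

/-! ### Smoothness of the covariant Legendre transform -/

section LegendreSmooth

variable {n m : ℕ} {X Y : Type*}
  [TopologicalSpace X] [ChartedSpace (Coord (n + 1)) X] [IsManifold (𝓡 (n + 1)) ∞ X]
  [TopologicalSpace Y] [ChartedSpace (Coord m) Y] [IsManifold (𝓡 m) ∞ Y]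
  {pr : C^∞⟮𝓡 m, Y; 𝓡 (n + 1), X⟯}
  {E' H' N : Type*} [NormedAddCommGroup E'] [NormedSpace ℝ E'] [TopologicalSpace H']
  {I : ModelWithCorners ℝ E' H'} [TopologicalSpace N] [ChartedSpace H' N]

/-- The derivative with respect to a real parameter of a smooth family of functions is smooth. -/
theorem contMDiffAt_deriv_param [IsManifold I 1 N] {F : N → ℝ → ℝ} {x₀ : N}
    (hF : ContMDiffAt (I.prod 𝓘(ℝ, ℝ)) 𝓘(ℝ, ℝ) ∞ (Function.uncurry F) (x₀, 0)) :
    ContMDiffAt I 𝓘(ℝ, ℝ) ∞ (fun x => deriv (F x) 0) x₀ := by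
  have h := ContMDiffAt.mfderiv (m := ∞) F (fun _ => (0 : ℝ)) hF contMDiffAt_const (by simp)
  have h2 := ((ContinuousLinearMap.apply ℝ ℝ (1 : ℝ)).contMDiff.contMDiffAt).comp x₀ h
  refine h2.congr_of_eventuallyEq (Filter.Eventually.of_forall fun x => ?_)
  have h3 := congrFun (inTangentCoordinates_model_space (I := 𝓘(ℝ, ℝ)) (I' := 𝓘(ℝ, ℝ))
    (fun _ : N => (0 : ℝ)) (fun x => F x 0) (fun x => mfderiv 𝓘(ℝ, ℝ) 𝓘(ℝ, ℝ) (F x) 0) x₀) x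
  refine Eq.trans ?_ (DFunLike.congr_fun h3.symm (1 : ℝ) : _)
  rw [mfderiv_eq_fderiv]
  exact (fderiv_apply_one_eq_deriv).symm

/-- The components of `T_y π` along a smooth map are smooth. -/
theorem contMDiffAt_proj_coord {f : N → Y} {x₀ : N} (hf : ContMDiffAt I (𝓡 m) ∞ f x₀) :
    ContMDiffAt I 𝓘(ℝ, Coord m →L[ℝ] Coord (n + 1)) ∞
      (fun x => (toC (pr (f x₀)) (pr (f x))).comp
        ((mfderiv (𝓡 m) (𝓡 (n + 1)) pr (f x)).comp (ofC (f x₀) (f x)))) x₀ :=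
  (contMDiffAt_mfderiv_coord (pr.contMDiff (f x₀))).comp x₀ hf

/-- The covariant Legendre transform of a smooth field of jets is smooth. -/
theorem contMDiffAt_legendre [IsManifold I 1 N] (L : LagrangianDensity pr) {f : N → Y}
    {g : ∀ x, PreJet pr (f x)} (hg : ∀ x, IsJet (g x)) {x₀ : N}
    (h : ContMDiffAt I (preJetModel n m) ∞ (fun x => (⟨f x, g x⟩ : PreJetBundle pr)) x₀)
    (σ : ∀ x, Form (d := m) (n + 1) (f x))
    (hσ : ∀ (x : N) (e : TangentSpace (𝓡 (n + 1)) (pr (f x)) ≃L[ℝ] Coord (n + 1))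
        (u : Fin (n + 1) → TangentSpace (𝓡 m) (f x)),
        (show ℝ from σ x u) =
          (show ℝ from L.toFun (f x) (g x)
            (fun i => mfderiv (𝓡 m) (𝓡 (n + 1)) pr (f x) (u i))) +
          ∑ i, ∑ j, deriv (fun ε : ℝ => (show ℝ from L.toFun (f x)
            (g x + ε • ((EuclideanSpace.proj j : Coord (n + 1) →L[ℝ] ℝ) ∘L
              (e : TangentSpace (𝓡 (n + 1)) (pr (f x)) →L[ℝ] Coord (n + 1))).smulRight
                (u i - g x (mfderiv (𝓡 m) (𝓡 (n + 1)) pr (f x) (u i))))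
            (Function.update (fun i => mfderiv (𝓡 m) (𝓡 (n + 1)) pr (f x) (u i)) i
              (e.symm (stdVec j))))) 0) :
    ContMDiffAt I (formModel m (n + 1)) ∞
      (fun x => (⟨f x, σ x⟩ : FormBundle m Y (n + 1))) x₀ := by
  obtain ⟨hf, hg'⟩ := contMDiffAt_preJet_iff.1 h
  have hT := contMDiffAt_proj_coord (pr := pr) hf
  have hpr : ContMDiffAt I (𝓡 (n + 1)) ∞ (fun x => pr (f x)) x₀ :=
    (pr.contMDiff (f x₀)).comp x₀ hf
  have hX := eventually_mem_chartDom (d := n + 1) hpr.continuousAt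
  have hY := eventually_mem_chartDom (d := m) hf.continuousAt
  refine contMDiffAt_form_iff.2 ⟨hf, fun û => ?_⟩
  let T : ∀ x, TangentSpace (𝓡 m) (f x) →L[ℝ] TangentSpace (𝓡 (n + 1)) (pr (f x)) :=
    fun x => mfderiv (𝓡 m) (𝓡 (n + 1)) pr (f x)
  let u : ∀ x, Fin (n + 1) → TangentSpace (𝓡 m) (f x) := fun x i => ofC (f x₀) (f x) (û i)
  let δ : ∀ (_ _ : Fin (n + 1)) (x : N), PreJet pr (f x) := fun i j x =>
    ((EuclideanSpace.proj j : Coord (n + 1) →L[ℝ] ℝ) ∘L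
      (toC (pr (f x₀)) (pr (f x)))).smulRight (u x i - g x (T x (u x i)))
  let w : ∀ (_ _ : Fin (n + 1)) (x : N), Fin (n + 1) → TangentSpace (𝓡 (n + 1)) (pr (f x)) :=
    fun i j x => Function.update (fun i => T x (u x i)) i (ofC (pr (f x₀)) (pr (f x)) (stdVec j))
  -- The frame is taken to be that of the chart of `X` at `π(f x₀)`, so the directions `δ` and
  -- arguments `w` have smooth components near `x₀`.
  have key : (fun x => (show ℝ from σ x (u x))) =ᶠ[𝓝 x₀] fun x =>
      (show ℝ from L.toFun (f x) (g x) (fun i => T x (u x i))) +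
        ∑ i, ∑ j, deriv (fun ε : ℝ => (show ℝ from L.toFun (f x)
          (g x + ε • δ i j x) (w i j x))) 0 := by
    filter_upwards [hX] with x hx
    exact hσ x (coordEquiv hx) (u x)
  have hTu : ∀ i, ContMDiffAt I 𝓘(ℝ, Coord (n + 1)) ∞
      (fun x => toC (pr (f x₀)) (pr (f x)) (T x (u x i))) x₀ := fun i =>
    hT.clm_apply contMDiffAt_const
  refine ContMDiffAt.congr_of_eventuallyEq ?_ key
  refine ContMDiffAt.add (contMDiffAt_form_apply (contMDiffAt_lagrangian L hg h) hTu) ?_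
  refine contMDiffAt_finsetSum fun i _ => contMDiffAt_finsetSum fun j _ => ?_
  refine contMDiffAt_deriv_param ?_
  have hfst : ContMDiffAt (I.prod 𝓘(ℝ, ℝ)) I ∞ (Prod.fst : N × ℝ → N) (x₀, (0 : ℝ)) :=
    contMDiffAt_fst
  -- Vertical directions keep `g x + ε • δ i j x` inside the jets for every `ε`; smoothness of `L`
  -- is available only there.
  have hTδ : ∀ x w, T x (δ i j x w) = 0 := by
    intro x w
    have h1 : δ i j x w = ((toC (pr (f x₀)) (pr (f x)) w) j) •
      (u x i - g x (T x (u x i))) := rfl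
    rw [h1, map_smul, map_sub]
    have h2 := isJet_iff.1 (hg x) (T x (u x i))
    rw [show T x (g x (T x (u x i))) = T x (u x i) from h2, sub_self, smul_zero]
  have hδ : ContMDiffAt I 𝓘(ℝ, Coord (n + 1) →L[ℝ] Coord m) ∞
      (fun x => (toC (f x₀) (f x)).comp ((δ i j x).comp (ofC (pr (f x₀)) (pr (f x))))) x₀ := by
    have h1 : ContMDiffAt I 𝓘(ℝ, Coord m) ∞ (fun x => û i -
        ((toC (f x₀) (f x)).comp ((g x).comp (ofC (pr (f x₀)) (pr (f x)))))
          (toC (pr (f x₀)) (pr (f x)) (T x (u x i)))) x₀ :=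
      contMDiffAt_const.sub (hg'.clm_apply (hTu i))
    have h2 : ContMDiffAt I 𝓘(ℝ, Coord (n + 1) →L[ℝ] Coord m) ∞ (fun x =>
        ContinuousLinearMap.smulRightL ℝ (Coord (n + 1)) (Coord m)
          (EuclideanSpace.proj j : Coord (n + 1) →L[ℝ] ℝ) (û i -
            ((toC (f x₀) (f x)).comp ((g x).comp (ofC (pr (f x₀)) (pr (f x)))))
              (toC (pr (f x₀)) (pr (f x)) (T x (u x i))))) x₀ :=
      ContMDiffAt.clm_apply contMDiffAt_const h1
    refine h2.congr_of_eventuallyEq ?_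
    filter_upwards [hX, hY] with x hx hy
    ext1 v
    change toC (f x₀) (f x) ((toC (pr (f x₀)) (pr (f x)) (ofC (pr (f x₀)) (pr (f x)) v)) j •
      (u x i - g x (T x (u x i)))) = v j • (û i - toC (f x₀) (f x) (g x (ofC (pr (f x₀)) (pr (f x))
          (toC (pr (f x₀)) (pr (f x)) (T x (u x i))))))
    rw [toC_ofC hx, ofC_toC hx, map_smul, map_sub, toC_ofC hy]
  -- Joint smoothness in `(x, ε)` is what makes the derivative at `ε = 0` smooth in `x`.
  have hG : ContMDiffAt (I.prod 𝓘(ℝ, ℝ)) (preJetModel n m) ∞ (fun q : N × ℝ =>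
      (⟨f q.1, g q.1 + q.2 • δ i j q.1⟩ : PreJetBundle pr)) (x₀, 0) := by
    refine contMDiffAt_preJet_iff.2 ⟨hf.comp (x₀, (0 : ℝ)) hfst, ?_⟩
    have h1 := (hg'.comp (x₀, (0 : ℝ)) hfst).add
      ((contMDiffAt_snd (I := I) (J := 𝓘(ℝ, ℝ)) (p := (x₀, (0 : ℝ)))).smul
        (hδ.comp (x₀, (0 : ℝ)) hfst))
    refine h1.congr_of_eventuallyEq (Filter.Eventually.of_forall fun q => ?_)
    ext1 v
    change toC (f x₀) (f q.1) (g q.1 _ + q.2 • δ i j q.1 _) = toC (f x₀) (f q.1) (g q.1 _) +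
      q.2 • toC (f x₀) (f q.1) (δ i j q.1 _)
    rw [map_add, map_smul]
  have hL := contMDiffAt_lagrangian L (fun q : N × ℝ => (hg q.1).add_smul (hTδ q.1) q.2) hG
  refine contMDiffAt_form_apply (w := fun q => w i j q.1) hL fun k => ?_
  have hw : ContMDiffAt I 𝓘(ℝ, Coord (n + 1)) ∞
      (fun x => toC (pr (f x₀)) (pr (f x)) (w i j x k)) x₀ := by
    rcases eq_or_ne k i with rfl | hk
    · refine (contMDiffAt_const (c := stdVec j)).congr_of_eventuallyEq ?_
      filter_upwards [hX] with x hx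
      simp only [w, Function.update_self]
      exact toC_ofC hx _
    · simp only [w, Function.update_of_ne hk]
      exact hTu k
  exact hw.comp (x₀, (0 : ℝ)) hfst

end LegendreSmooth

/-! ### Pointwise algebra of the instantaneous Legendre transform -/

section Split

variable {n : ℕ} {E : Type*} [NormedAddCommGroup E] [NormedSpace ℝ E]

/-- `ℝⁿ⁺¹` is the direct sum of the image of `B` and the line spanned by `ζ`. -/
def IsSplit (B : Coord n →L[ℝ] Coord (n + 1)) (ζ : Coord (n + 1)) : Prop :=
  ∃ e : (Coord n × ℝ) ≃L[ℝ] Coord (n + 1),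
    (e : (Coord n × ℝ) →L[ℝ] Coord (n + 1)) = B.coprod (ContinuousLinearMap.toSpanSingleton ℝ ζ)

theorem isSplit_of_injective {B : Coord n →L[ℝ] Coord (n + 1)} {ζ : Coord (n + 1)}
    (hB : Function.Injective B) (hζ : ζ ∉ Set.range B) : IsSplit B ζ := by
  let C := B.coprod (ContinuousLinearMap.toSpanSingleton ℝ ζ)
  have hC : ∀ a c, C (a, c) = B a + c • ζ := fun a c => rfl
  have hinj : Function.Injective C := by
    rw [injective_iff_map_eq_zero]
    rintro ⟨a, c⟩ h
    rw [hC] at h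
    have hc : c = 0 := by
      by_contra hc
      -- Solving `B a + c • ζ = 0` for `ζ`.
      refine hζ ⟨-(c⁻¹ • a), ?_⟩
      rw [map_neg, map_smul, eq_neg_of_add_eq_zero_left h, smul_neg, neg_neg, smul_smul,
        inv_mul_cancel₀ hc, one_smul]
    subst hc
    rw [zero_smul, add_zero] at h
    rw [(injective_iff_map_eq_zero B).1 hB a h]
    rfl
  have hdim : Module.finrank ℝ (Coord n × ℝ) = Module.finrank ℝ (Coord (n + 1)) := by simp
  let e := (LinearEquiv.ofInjectiveOfFinrankEq C.toLinearMap hinj hdim).toContinuousLinearEquiv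
  exact ⟨e, ContinuousLinearMap.ext fun _ => rfl⟩

variable {B : Coord n →L[ℝ] Coord (n + 1)} {ζ : Coord (n + 1)}

/-- `ContinuousLinearMap.inverse` is zero on non-invertible maps; the splitting ensures that it is a
genuine inverse. -/
theorem IsSplit.inverse_left (h : IsSplit B ζ) (a : Coord n) (c : ℝ) :
    (B.coprod (ContinuousLinearMap.toSpanSingleton ℝ ζ)).inverse (B a + c • ζ) = (a, c) := by
  obtain ⟨e, he⟩ := h
  have h1 : B a + c • ζ = e (a, c) := by
    change _ = (e : (Coord n × ℝ) →L[ℝ] Coord (n + 1)) (a, c)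
    rw [he]
    rfl
  rw [← he, ContinuousLinearMap.inverse_equiv, h1]
  exact e.symm_apply_apply _

theorem IsSplit.exists_eq (h : IsSplit B ζ) (w : Coord (n + 1)) :
    ∃ (a : Coord n) (c : ℝ), w = B a + c • ζ := by
  obtain ⟨e, he⟩ := h
  refine ⟨(e.symm w).1, (e.symm w).2, ?_⟩
  have h1 : e (e.symm w) = B (e.symm w).1 + (e.symm w).2 • ζ :=
    DFunLike.congr_fun he (e.symm w)
  rw [← h1, e.apply_symm_apply]

/-- The linear map with restriction `D` to the image of `B` and value `v + ζ'` on `ζ`. -/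
def glue (D : Coord n →L[ℝ] E) (B : Coord n →L[ℝ] Coord (n + 1)) (ζ : Coord (n + 1)) (ζ' v : E) :
    Coord (n + 1) →L[ℝ] E :=
  (D.coprod (ContinuousLinearMap.toSpanSingleton ℝ (v + ζ'))).comp
    (B.coprod (ContinuousLinearMap.toSpanSingleton ℝ ζ)).inverse

/-- The linear form vanishing on the image of `B` with value `1` on `ζ`. -/
def conormal (B : Coord n →L[ℝ] Coord (n + 1)) (ζ : Coord (n + 1)) : Coord (n + 1) →L[ℝ] ℝ :=
  (ContinuousLinearMap.snd ℝ (Coord n) ℝ).comp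
    (B.coprod (ContinuousLinearMap.toSpanSingleton ℝ ζ)).inverse

theorem IsSplit.glue_apply (h : IsSplit B ζ) (D : Coord n →L[ℝ] E) (ζ' v : E) (a : Coord n)
    (c : ℝ) : glue D B ζ ζ' v (B a + c • ζ) = D a + c • (v + ζ') := by
  rw [glue, ContinuousLinearMap.comp_apply, h.inverse_left]
  rfl

theorem IsSplit.glue_image (h : IsSplit B ζ) (D : Coord n →L[ℝ] E) (ζ' v : E) (a : Coord n) :
    glue D B ζ ζ' v (B a) = D a := by
  simpa using h.glue_apply D ζ' v a 0

theorem IsSplit.glue_normal (h : IsSplit B ζ) (D : Coord n →L[ℝ] E) (ζ' v : E) :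
    glue D B ζ ζ' v ζ = v + ζ' := by
  simpa using h.glue_apply D ζ' v 0 1

theorem IsSplit.conormal_apply (h : IsSplit B ζ) (a : Coord n) (c : ℝ) :
    conormal B ζ (B a + c • ζ) = c := by
  rw [conormal, ContinuousLinearMap.comp_apply, h.inverse_left]
  rfl

/-- Maps with a fixed restriction to the image of `B` form an affine space: changing the velocity by
`w` adds a rank-one term that only sees the component along `ζ`. -/
theorem IsSplit.glue_add (h : IsSplit B ζ) (D : Coord n →L[ℝ] E) (ζ' v w : E) :
    glue D B ζ ζ' (v + w) = glue D B ζ ζ' v + (conormal B ζ).smulRight w := by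
  ext1 p
  obtain ⟨a, c, rfl⟩ := h.exists_eq p
  rw [add_apply, ContinuousLinearMap.smulRight_apply, h.glue_apply, h.glue_apply, h.conormal_apply]
  module

/-- Conversely to the construction, a jet with prescribed restriction is the reconstruction of its
own velocity `g ζ - ζ'`. -/
theorem IsSplit.eq_glue (h : IsSplit B ζ) {D : Coord n →L[ℝ] E} {g : Coord (n + 1) →L[ℝ] E}
    (hg : ∀ a, g (B a) = D a) (ζ' : E) : g = glue D B ζ ζ' (g ζ - ζ') := by
  ext1 p
  obtain ⟨a, c, rfl⟩ := h.exists_eq p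
  rw [h.glue_apply, map_add, map_smul, hg, sub_add_cancel]

theorem IsSplit.comp_glue (h : IsSplit B ζ) {T : E →L[ℝ] Coord (n + 1)} {D : Coord n →L[ℝ] E}
    (hD : ∀ a, T (D a) = B a) {ζ' v : E} (hζ' : T ζ' = ζ) (hv : T v = 0) (w : Coord (n + 1)) :
    T (glue D B ζ ζ' v w) = w := by
  obtain ⟨a, c, rfl⟩ := h.exists_eq w
  rw [h.glue_apply, map_add, map_smul, map_add, hD, hζ', hv, zero_add]

/-- A form of degree `n + 1` vanishes on the image of `ℝⁿ`. -/
theorem alternating_apply_image_eq_zero (z : E [⋀^Fin (n + 1)]→L[ℝ] ℝ) (D : Coord n →L[ℝ] E)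
    (u : Fin (n + 1) → Coord n) : z (fun i => D (u i)) = 0 := by
  refine (z.compContinuousLinearMap D).toAlternatingMap.map_linearDependent u fun hu => ?_
  have := hu.fintype_card_le_finrank
  simp at this

/-- Contraction of the first slot of a form, as a linear form. -/
def slot (z : E [⋀^Fin (n + 1)]→L[ℝ] ℝ) (p : Fin n → E) : E →L[ℝ] ℝ :=
  (ContinuousAlternatingMap.apply ℝ E ℝ p) ∘L z.curryLeft

theorem slot_apply (z : E [⋀^Fin (n + 1)]→L[ℝ] ℝ) (p : Fin n → E) (w : E) :
    slot z p w = z (Matrix.vecCons w p) := rfl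

theorem map_vecCons {V W : Type*} (f : V → W) (w : V) (p : Fin n → V) :
    (fun i => f (Matrix.vecCons w p i : V)) = (Matrix.vecCons (f w) (fun i => f (p i)) :
      Fin (n + 1) → W) := by
  ext1 i
  refine Fin.cases ?_ (fun i => ?_) i <;> rfl

/-! ### Momentum and energy of a Legendre transform. -/

section Lift

variable {T : E →L[ℝ] Coord (n + 1)} {D : Coord n →L[ℝ] E} {ζ' : E}
  {Λ : (Coord (n + 1) →L[ℝ] E) → Coord (n + 1) [⋀^Fin (n + 1)]→L[ℝ] ℝ}

/-- The momentum of a Legendre transform is the fibre derivative of the instantaneous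
Lagrangian. -/
theorem IsSplit.slot_eq_deriv (h : IsSplit B ζ) {g : Coord (n + 1) →L[ℝ] E}
    (hT : ∀ w, T (g w) = w) (hg : ∀ a, g (B a) = D a) {z : E [⋀^Fin (n + 1)]→L[ℝ] ℝ}
    (hz : ∀ γ' : Coord (n + 1) →L[ℝ] E, (∀ w, T (γ' w) = w) → ∀ u : Fin (n + 1) → Coord (n + 1),
        z (fun i => γ' (u i)) = Λ g u + deriv (fun ε : ℝ => Λ (g + ε • (γ' - g)) u) 0)
    {w : E} (hw : T w = 0) (u : Fin n → Coord n) :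
    slot z (fun i => D (u i)) w =
      deriv (fun ε : ℝ => Λ (glue D B ζ ζ' (g ζ - ζ' + ε • w))
        (Matrix.vecCons ζ (fun i => B (u i)))) 0 := by
  have hl : ∀ a, conormal B ζ (B a) = 0 := fun a => by simpa using h.conormal_apply a 0
  have hl1 : conormal B ζ ζ = 1 := by simpa using h.conormal_apply 0 1
  -- The Taylor formula is compared at `g` and at `g + conormal ⊗ w`. These agree along `B` and
  -- differ by `w` on `ζ`, so the difference of the two values of `z` is its contraction with `w`.
  have h0 := hz g hT (Matrix.vecCons ζ (fun i => B (u i)))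
  have h1 := hz (g + (conormal B ζ).smulRight w) (fun p => by simp [hT, hw])
    (Matrix.vecCons ζ (fun i => B (u i)))
  rw [map_vecCons] at h0 h1
  have e0 : deriv (fun ε : ℝ => Λ (g + ε • (g - g)) (Matrix.vecCons ζ (fun i => B (u i)))) 0 = 0 := by
    simp only [sub_self, smul_zero, deriv_const]
  have e1 : (g + (conormal B ζ).smulRight w) ζ = g ζ + w := by simp [hl1]
  have e2 : ∀ i, (g + (conormal B ζ).smulRight w) (B (u i)) = D (u i) := fun i => by
    simp [hl, hg]
  rw [e0, add_zero] at h0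
  rw [e1, add_sub_cancel_left] at h1
  rw [show (fun i => g (B (u i))) = fun i => D (u i) from funext fun i => hg (u i)] at h0
  rw [show (fun i => (g + (conormal B ζ).smulRight w) (B (u i))) = fun i => D (u i) from
    funext e2] at h1
  rw [← slot_apply] at h0 h1
  rw [map_add, h0, add_right_inj] at h1
  rw [h1]
  congr 1
  ext ε
  rw [h.glue_add, ← h.eq_glue hg ζ']
  congr 3
  exact ContinuousLinearMap.ext fun p => smul_comm ε (conormal B ζ p) w

/-- Along a curve in a fibre of the fibre derivative, the instantaneous Lagrangian changes by the
pairing of the momentum with the velocity. -/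
theorem lagrangian_sub_eq {l : Coord (n + 1) →L[ℝ] ℝ} {g : Coord (n + 1) →L[ℝ] E}
    {Ω : Fin (n + 1) → Coord (n + 1)} (hT : ∀ w, T (g w) = w)
    (hΛ : ContDiff ℝ ∞ fun w : E => Λ (g + l.smulRight (w - g (T w))) Ω)
    (M : E →L[ℝ] ℝ) {c : ℝ → E} (hc : ContDiff ℝ ∞ c) (hcT : ∀ s ∈ Set.Icc (0 : ℝ) 1, T (c s) = 0)
    (hM : ∀ s ∈ Set.Icc (0 : ℝ) 1, ∀ w, T w = 0 →
      deriv (fun ε : ℝ => Λ (g + l.smulRight (c s - c 0 + ε • w)) Ω) 0 = M w) :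
    Λ (g + l.smulRight (c 1 - c 0)) Ω - Λ g Ω = M (c 1 - c 0) := by
  -- The projection onto `ker T` along `g` makes `H` smooth on all of `E`, and spares a proof that
  -- `ċ` is vertical: `P ċ` is so by construction.
  let P : E →L[ℝ] E := ContinuousLinearMap.id ℝ E - g ∘L T
  have hP : ∀ w, P w = w - g (T w) := fun w => rfl
  have hTP : ∀ w, T (P w) = 0 := fun w => by rw [hP, map_sub, hT, sub_self]
  have hP0 : ∀ w, T w = 0 → P w = w := fun w hw => by rw [hP, hw, map_zero, sub_zero]
  have h01 : (0 : ℝ) ∈ Set.Icc (0 : ℝ) 1 := by simp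
  have h11 : (1 : ℝ) ∈ Set.Icc (0 : ℝ) 1 := by simp
  let H : E → ℝ := fun w => Λ (g + l.smulRight (P w)) Ω
  have hH : ContDiff ℝ ∞ H := hΛ
  have hcd : Differentiable ℝ c := hc.differentiable (by simp)
  have hHd : Differentiable ℝ H := hH.differentiable (by simp)
  have hcs : ∀ s ∈ Set.Icc (0 : ℝ) 1, P (c s - c 0) = c s - c 0 := fun s hs =>
    hP0 _ (by rw [map_sub, hcT s hs, hcT 0 h01, sub_zero])
  -- Constancy of the energy: the fibre condition in direction `P ċ` says that the two derivatives
  -- cancel.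
  have hder : ∀ s ∈ Set.Icc (0 : ℝ) 1,
      HasDerivAt (fun s => H (c s - c 0) - M (P (c s))) 0 s := by
    intro s hs
    have h1 : HasDerivAt c (deriv c s) s := (hcd s).hasDerivAt
    have h2 := (hHd (c s - c 0)).hasFDerivAt.comp_hasDerivAt s (h1.sub_const (c 0))
    have h3 := (M ∘L P).hasFDerivAt.comp_hasDerivAt s h1
    have h4 : fderiv ℝ H (c s - c 0) (deriv c s) = M (P (deriv c s)) := by
      rw [← hM s hs _ (hTP _)]
      have h5 : HasDerivAt (fun ε : ℝ => c s - c 0 + ε • deriv c s) (deriv c s) 0 := by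
        simpa using ((hasDerivAt_id (0 : ℝ)).smul_const (deriv c s)).const_add (c s - c 0)
      have h6 : HasFDerivAt H (fderiv ℝ H (c s - c 0)) (c s - c 0 + (0 : ℝ) • deriv c s) := by
        rw [zero_smul, add_zero]
        exact (hHd _).hasFDerivAt
      rw [← (h6.comp_hasDerivAt (0 : ℝ) h5).deriv]
      congr 1
      ext ε
      simp only [Function.comp, H]
      rw [map_add, map_smul, hcs s hs]
    have h7 := h2.sub h3
    have h8 : fderiv ℝ H (c s - c 0) (deriv c s) - (M ∘L P) (deriv c s) = 0 :=
      sub_eq_zero.2 h4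
    rw [h8] at h7
    exact h7
  have hconst := constant_of_has_deriv_right_zero
    (fun s hs => (hder s hs).continuousAt.continuousWithinAt)
    (fun s hs => (hder s ⟨hs.1, hs.2.le⟩).hasDerivWithinAt) 1 h11
  simp only [H, hcs 1 h11, sub_self, map_zero] at hconst
  rw [hP0 _ (hcT 1 h11), hP0 _ (hcT 0 h01)] at hconst
  have h0 : l.smulRight (0 : E) = 0 := by ext; simp
  rw [h0, add_zero] at hconst
  rw [map_sub]
  linarith

/-- Two Legendre transforms with the same momenta whose velocities are joined by a curve in a fibre
of the fibre derivative have the same energy-momentum. -/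
theorem IsSplit.slot_eq_slot (h : IsSplit B ζ) (hD : ∀ a, T (D a) = B a)
    (hΛ : ∀ f : E → Coord (n + 1) →L[ℝ] E, ContDiff ℝ ∞ f → (∀ w p, T (f w p) = p) →
      ∀ Ω, ContDiff ℝ ∞ fun w => Λ (f w) Ω)
    {g g' : Coord (n + 1) →L[ℝ] E} (hT : ∀ w, T (g w) = w) (hg : ∀ a, g (B a) = D a)
    (hT' : ∀ w, T (g' w) = w) (hg' : ∀ a, g' (B a) = D a)
    {z z' : E [⋀^Fin (n + 1)]→L[ℝ] ℝ} (hz : ∀ u, z (fun i => g (u i)) = Λ g u)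
    (hz' : ∀ u, z' (fun i => g' (u i)) = Λ g' u) (u : Fin n → Coord n)
    (hzz' : ∀ w, T w = 0 → slot z (fun i => D (u i)) w = slot z' (fun i => D (u i)) w)
    {c : ℝ → E} (hc : ContDiff ℝ ∞ c) (hc0 : c 0 = g ζ - ζ') (hc1 : c 1 = g' ζ - ζ')
    (hcT : ∀ s ∈ Set.Icc (0 : ℝ) 1, T (c s) = 0)
    (hM : ∀ s ∈ Set.Icc (0 : ℝ) 1, ∀ w, T w = 0 →
      deriv (fun ε : ℝ => Λ (glue D B ζ ζ' (c s + ε • w))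
        (Matrix.vecCons ζ (fun i => B (u i)))) 0 = slot z (fun i => D (u i)) w) (η : E) :
    slot z (fun i => D (u i)) η = slot z' (fun i => D (u i)) η := by
  set M := slot z (fun i => D (u i)) with hMdef
  set M' := slot z' (fun i => D (u i)) with hMdef'
  set Ω : Fin (n + 1) → Coord (n + 1) := Matrix.vecCons ζ (fun i => B (u i)) with hΩ
  have hglue : ∀ v, glue D B ζ ζ' v = g + (conormal B ζ).smulRight (v - c 0) := by
    intro v
    have h1 := h.glue_add D ζ' (c 0) (v - c 0)
    rw [add_sub_cancel] at h1
    rw [h1, hc0, ← h.eq_glue hg ζ']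
  have hdiff : Λ g' Ω - Λ g Ω = M (c 1 - c 0) := by
    have h1 := lagrangian_sub_eq (l := conormal B ζ) (Ω := Ω) (Λ := Λ) hT
      (hΛ _ (contDiff_const.add ((ContinuousLinearMap.smulRightL ℝ (Coord (n + 1)) E
        (conormal B ζ)).contDiff.comp (contDiff_id.sub
          (g.contDiff.comp T.contDiff)))) (fun w p => by simp [hT]) Ω) M hc hcT
      (fun s hs w hw => by
        rw [← hM s hs w hw]
        congr 1
        ext ε
        rw [hglue, add_sub_right_comm])
    rw [← h1, ← hglue, hc1, ← h.eq_glue hg' ζ']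
  have hMg : M (g ζ) = Λ g Ω := by
    rw [hMdef, slot_apply, ← hz, hΩ, map_vecCons]
    simp only [hg]
  have hMg' : M' (g' ζ) = Λ g' Ω := by
    rw [hMdef', slot_apply, ← hz', hΩ, map_vecCons]
    simp only [hg']
  -- All `n + 1` arguments lie in the image of `ℝⁿ` under `D`.
  have hMD : ∀ a, M (D a) = 0 := by
    intro a
    rw [hMdef, slot_apply, ← map_vecCons]
    exact alternating_apply_image_eq_zero z D _
  have hMD' : ∀ a, M' (D a) = 0 := by
    intro a
    rw [hMdef', slot_apply, ← map_vecCons]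
    exact alternating_apply_image_eq_zero z' D _
  -- With `T η = B a + k • ζ`, subtracting `D a` and `k • g ζ`, or `k • g' ζ`, leaves vertical
  -- remainders that differ by `k • (c 1 - c 0)`. Hence `M' η - M η` is `k` times `Λ g' Ω - Λ g Ω -
  -- M (c 1 - c 0)`, which is zero by `hdiff`.
  obtain ⟨a, k, hak⟩ := h.exists_eq (T η)
  have e1 : η = D a + k • g ζ + (η - D a - k • g ζ) := by abel
  have e2 : η = D a + k • g' ζ + (η - D a - k • g' ζ) := by abel
  have t2 : T (η - D a - k • g' ζ) = 0 := by
    rw [map_sub, map_sub, map_smul, hT', hD, hak]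
    abel
  have e3 : η - D a - k • g' ζ = (η - D a - k • g ζ) - k • (c 1 - c 0) := by
    rw [hc0, hc1]
    module
  have r1 : M η = k * Λ g Ω + M (η - D a - k • g ζ) := by
    conv_lhs => rw [e1]
    rw [map_add, map_add, map_smul, hMD, hMg, zero_add, smul_eq_mul]
  have r2 : M' η = k * Λ g' Ω + M (η - D a - k • g' ζ) := by
    conv_lhs => rw [e2]
    rw [map_add, map_add, map_smul, hMD', hMg', ← hzz' _ t2, zero_add, smul_eq_mul]
  rw [r1, r2, e3, map_sub M _ (k • (c 1 - c 0)), map_smul, ← hdiff, smul_eq_mul]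
  ring

end Lift

end Split

/-! ### Derivatives of immersions and of bundle projections -/

section Derivatives

variable {d d' : ℕ} {M M' : Type*} [TopologicalSpace M] [ChartedSpace (Coord d) M]
  [IsManifold (𝓡 d) ∞ M] [TopologicalSpace M'] [ChartedSpace (Coord d') M']
  [IsManifold (𝓡 d') ∞ M']

/-- In suitable charts an immersion is `u ↦ (u, 0)` up to a linear equivalence, so projecting the
codomain chart to the first factor recovers the domain chart, whose derivative is injective; the
chain rule gives the claim. -/
theorem mfderiv_injective_of_isImmersionAt {f : M → M'} {x : M}
    (hf : Manifold.IsImmersionAt (𝓡 d) (𝓡 d') ∞ f x) :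
    Function.Injective (mfderiv (𝓡 d) (𝓡 d') f x) := by
  have hdom : hf.domChart.MDifferentiable (𝓡 d) (𝓡 d) :=
    ⟨(contMDiffOn_of_mem_maximalAtlas hf.domChart_mem_maximalAtlas).mdifferentiableOn (by simp),
      (contMDiffOn_symm_of_mem_maximalAtlas hf.domChart_mem_maximalAtlas).mdifferentiableOn
        (by simp)⟩
  have hcod : MDifferentiableAt (𝓡 d') (𝓡 d') hf.codChart (f x) :=
    ((contMDiffOn_of_mem_maximalAtlas hf.codChart_mem_maximalAtlas).contMDiffAt
      (hf.codChart.open_source.mem_nhds hf.mem_codChart_source)).mdifferentiableAt (by simp)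
  have hfx : MDifferentiableAt (𝓡 d) (𝓡 d') f x := hf.contMDiffAt.mdifferentiableAt (by simp)
  let ℓ := (ContinuousLinearMap.fst ℝ (Coord d) hf.complement) ∘L
    (hf.equiv.symm : Coord d' →L[ℝ] _)
  have heq : (fun x' => ℓ (hf.codChart (f x'))) =ᶠ[𝓝 x] hf.domChart := by
    filter_upwards [hf.domChart.open_source.mem_nhds hf.mem_domChart_source] with x' hx'
    have h1 := hf.writtenInCharts (show hf.domChart x' ∈ (hf.domChart.extend (𝓡 d)).target by
      simpa using hf.domChart.map_source hx')
    simp only [Function.comp_apply, OpenPartialHomeomorph.extend_coe_symm,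
      OpenPartialHomeomorph.extend_coe, modelWithCornersSelf_coe, modelWithCornersSelf_coe_symm,
      id_eq, hf.domChart.left_inv hx'] at h1
    simp [ℓ, h1]
  have hcomp : MDifferentiableAt (𝓡 d') (𝓡 d) (fun p => ℓ (hf.codChart p)) (f x) :=
    ℓ.mdifferentiableAt.comp (f x) hcod
  have h2 : mfderiv (𝓡 d) (𝓡 d) hf.domChart x =
      (mfderiv (𝓡 d') (𝓡 d) (fun p => ℓ (hf.codChart p)) (f x)).comp
        (mfderiv (𝓡 d) (𝓡 d') f x) := by
    rw [← heq.mfderiv_eq]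
    exact mfderiv_comp x hcomp hfx
  have h3 := hdom.mfderiv_injective hf.mem_domChart_source
  rw [h2] at h3
  exact Function.Injective.of_comp h3

/-- In the bundle chart at `z` the projection is literally `Prod.fst`. The explicit derivative is
needed because `canonicalLift` is defined by its components in that chart. -/
theorem hasMFDerivAt_formBundle_proj {k : ℕ} (z : FormBundle d M k) :
    HasMFDerivAt (formModel d k) (𝓡 d) (TotalSpace.proj : FormBundle d M k → M) z
      (show Coord d × (Coord d [⋀^Fin k]→L[ℝ] ℝ) →L[ℝ] Coord d from
        ContinuousLinearMap.fst ℝ (Coord d) (Coord d [⋀^Fin k]→L[ℝ] ℝ)) := by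
  refine ⟨(FiberBundle.continuous_proj _ _).continuousAt, ?_⟩
  have h : HasFDerivWithinAt (Prod.fst : Coord d × (Coord d [⋀^Fin k]→L[ℝ] ℝ) → Coord d)
      (ContinuousLinearMap.fst ℝ (Coord d) (Coord d [⋀^Fin k]→L[ℝ] ℝ))
      (Set.range (formModel d k)) (extChartAt (formModel d k) z z) :=
    hasFDerivAt_fst.hasFDerivWithinAt
  have heq : ∀ p ∈ (extChartAt (formModel d k) z).target,
      writtenInExtChartAt (formModel d k) (𝓡 d) z (TotalSpace.proj : FormBundle d M k → M) p =
        p.1 := by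
    intro p hp
    rw [extChartAt_target] at hp
    have h1 := FiberBundle.chartedSpace_chartAt_symm_fst z p hp.1
    have h2 : p.1 ∈ (chartAt (Coord d) z.proj).target := by
      have h3 := hp.1
      simp only [FiberBundle.chartedSpace_chartAt, mfld_simps] at h3
      exact h3.1.1
    exact (congrArg (chartAt (Coord d) z.proj) h1).trans
      ((chartAt (Coord d) z.proj).right_inv h2)
  refine h.congr_of_eventuallyEq ?_ (heq _ (mem_extChartAt_target z))
  filter_upwards [extChartAt_target_mem_nhdsWithin (I := formModel d k) z] with p hp
  exact heq p hp

end Derivatives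

/-! ### Fields, velocities and jets along the Cauchy surface -/

section Fields

variable {n m : ℕ} {X Y S : Type*}
  [TopologicalSpace X] [ChartedSpace (Coord (n + 1)) X] [IsManifold (𝓡 (n + 1)) ∞ X]
  [TopologicalSpace Y] [ChartedSpace (Coord m) Y] [IsManifold (𝓡 m) ∞ Y]
  [TopologicalSpace S] [ChartedSpace (Coord n) S] [IsManifold (𝓡 n) ∞ S]
  {pr : C^∞⟮𝓡 m, Y; 𝓡 (n + 1), X⟯} {τ : S → X}

theorem Config.comp_eq (φ : Config pr τ) : (fun x => pr (φ.toFun x)) = τ :=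
  funext φ.covers

theorem Config.baseDeriv_apply (φ : Config pr τ) (x : S) (a : TangentSpace (𝓡 n) x) :
    mfderiv (𝓡 m) (𝓡 (n + 1)) pr (φ.toFun x) (φ.deriv x a) = φ.baseDeriv x a := by
  have h := mfderiv_comp x ((pr.contMDiff (φ.toFun x)).mdifferentiableAt (by simp))
    ((φ.smooth x).mdifferentiableAt (by simp))
  exact (DFunLike.congr_fun h a).symm

theorem isSplit_baseDeriv (hτ : Manifold.IsSmoothEmbedding (𝓡 n) (𝓡 (n + 1)) ∞ τ)
    (ζ : InfSlicing pr τ) (φ : Config pr τ) (x : S) :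
    IsSplit (n := n) (φ.baseDeriv x) (ζ.onX (pr (φ.toFun x))) := by
  -- The types depend on `pr (φ.toFun x)`, equal to `τ x` only propositionally; a variable `f` in
  -- place of `pr ∘ φ` permits substitution.
  have key : ∀ f : S → X, f = τ → Function.Injective (mfderiv (𝓡 n) (𝓡 (n + 1)) f x) ∧
      ζ.onX (f x) ∉ Set.range (mfderiv (𝓡 n) (𝓡 (n + 1)) f x) := by
    rintro f rfl
    exact ⟨mfderiv_injective_of_isImmersionAt (hτ.isImmersion.isImmersionAt x), ζ.transverse x⟩
  obtain ⟨h1, h2⟩ := key _ φ.comp_eq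
  exact isSplit_of_injective h1 h2

theorem InfSlicing.projects_field (ζ : InfSlicing pr τ) (φ : Config pr τ) (x : S) :
    mfderiv (𝓡 m) (𝓡 (n + 1)) pr (φ.toFun x) (ζ.onY (φ.toFun x)) = ζ.onX (pr (φ.toFun x)) :=
  ζ.projects _ ⟨x, (φ.covers x).symm⟩

theorem InfSlicing.contMDiff_onX (ζ : InfSlicing pr τ) (φ : Config pr τ) :
    ContMDiff (𝓡 n) (𝓡 (n + 1)).tangent ∞ (fun x : S =>
      (⟨pr (φ.toFun x), ζ.onX (pr (φ.toFun x))⟩ : TangentBundle (𝓡 (n + 1)) X)) := by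
  have key : ∀ f : S → X, f = τ → ContMDiff (𝓡 n) (𝓡 (n + 1)).tangent ∞ (fun x : S =>
      (⟨f x, ζ.onX (f x)⟩ : TangentBundle (𝓡 (n + 1)) X)) := by
    rintro f rfl
    exact ζ.smooth_onX
  exact key _ φ.comp_eq

theorem InfSlicing.contMDiff_onY (ζ : InfSlicing pr τ) (φ : Config pr τ) :
    ContMDiff (𝓡 n) (𝓡 m).tangent ∞ (fun x : S =>
      (⟨φ.toFun x, ζ.onY (φ.toFun x)⟩ : TangentBundle (𝓡 m) Y)) :=
  ζ.smooth_onY.comp_contMDiff φ.smooth fun x => ⟨x, (φ.covers x).symm⟩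

/-- Operator inversion is smooth at invertible operators, so a splitting at `x₀` alone suffices. -/
theorem contMDiffAt_glue {E' H' N : Type*} [NormedAddCommGroup E'] [NormedSpace ℝ E']
    [TopologicalSpace H'] {I : ModelWithCorners ℝ E' H'} [TopologicalSpace N] [ChartedSpace H' N]
    {D : N → Coord n →L[ℝ] Coord m} {B : N → Coord n →L[ℝ] Coord (n + 1)} {ζ : N → Coord (n + 1)}
    {ζ' v : N → Coord m} {x₀ : N} (hD : ContMDiffAt I 𝓘(ℝ, Coord n →L[ℝ] Coord m) ∞ D x₀)
    (hB : ContMDiffAt I 𝓘(ℝ, Coord n →L[ℝ] Coord (n + 1)) ∞ B x₀)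
    (hζ : ContMDiffAt I 𝓘(ℝ, Coord (n + 1)) ∞ ζ x₀)
    (hζ' : ContMDiffAt I 𝓘(ℝ, Coord m) ∞ ζ' x₀) (hv : ContMDiffAt I 𝓘(ℝ, Coord m) ∞ v x₀)
    (h : IsSplit (B x₀) (ζ x₀)) :
    ContMDiffAt I 𝓘(ℝ, Coord (n + 1) →L[ℝ] Coord m) ∞
      (fun x => glue (D x) (B x) (ζ x) (ζ' x) (v x)) x₀ := by
  have hcoprod : ∀ {k : ℕ} {A : N → Coord n →L[ℝ] Coord k} {w : N → Coord k},
      ContMDiffAt I 𝓘(ℝ, Coord n →L[ℝ] Coord k) ∞ A x₀ → ContMDiffAt I 𝓘(ℝ, Coord k) ∞ w x₀ →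
      ContMDiffAt I 𝓘(ℝ, (Coord n × ℝ) →L[ℝ] Coord k) ∞
        (fun x => (A x).coprod (ContinuousLinearMap.toSpanSingleton ℝ (w x))) x₀ := by
    intro k A w hA hw
    have h1 : ContMDiffAt I 𝓘(ℝ, (Coord n × ℝ) →L[ℝ] Coord k) ∞ (fun x =>
        (A x).comp (ContinuousLinearMap.fst ℝ (Coord n) ℝ) +
          ContinuousLinearMap.smulRightL ℝ (Coord n × ℝ) (Coord k)
            (ContinuousLinearMap.snd ℝ (Coord n) ℝ) (w x)) x₀ :=
      (hA.clm_comp contMDiffAt_const).add (contMDiffAt_const.clm_apply hw)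
    exact h1
  refine (hcoprod hD (hv.add hζ')).clm_comp ?_
  obtain ⟨e, he⟩ := h
  have h2 : ContDiffAt ℝ ∞ (ContinuousLinearMap.inverse :
      ((Coord n × ℝ) →L[ℝ] Coord (n + 1)) → _)
      ((B x₀).coprod (ContinuousLinearMap.toSpanSingleton ℝ (ζ x₀))) := by
    rw [← he]
    exact contDiffAt_map_inverse e
  exact h2.contMDiffAt.comp x₀ (hcoprod hB hζ)

theorem IsSplit.injective {B : Coord n →L[ℝ] Coord (n + 1)} {ζ : Coord (n + 1)} (h : IsSplit B ζ) :
    Function.Injective B := fun a b hab => by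
  have h1 := h.inverse_left a 0
  rw [hab, h.inverse_left] at h1
  exact (congrArg Prod.fst h1).symm

theorem IsSplit.notMem_range {B : Coord n →L[ℝ] Coord (n + 1)} {ζ : Coord (n + 1)}
    (h : IsSplit B ζ) : ζ ∉ Set.range B := by
  rintro ⟨a, ha⟩
  have h1 := h.inverse_left a 0
  have h2 := h.inverse_left 0 1
  rw [map_zero, zero_add, one_smul] at h2
  rw [zero_smul, add_zero, ha, h2] at h1
  exact one_ne_zero (congrArg Prod.snd h1)

/-- Splittings are preserved by changes of coordinates. -/
theorem IsSplit.conj {B : Coord n →L[ℝ] Coord (n + 1)} {ζ : Coord (n + 1)} (h : IsSplit B ζ)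
    {tX : Coord (n + 1) →L[ℝ] Coord (n + 1)} (hX : Function.Injective tX)
    {oS : Coord n →L[ℝ] Coord n} (hS : Function.Injective oS) :
    IsSplit (tX.comp (B.comp oS)) (tX ζ) := by
  refine isSplit_of_injective (hX.comp (h.injective.comp hS)) ?_
  rintro ⟨a, ha⟩
  exact h.notMem_range ⟨oS a, hX ha⟩

/-- The gluing of linear maps commutes with changes of coordinates. -/
theorem IsSplit.glue_conj {B : Coord n →L[ℝ] Coord (n + 1)} {ζ : Coord (n + 1)} (h : IsSplit B ζ)
    {tX oX : Coord (n + 1) →L[ℝ] Coord (n + 1)} (hX : ∀ w, oX (tX w) = w)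
    {oS : Coord n →L[ℝ] Coord n} (hS : Function.Injective oS) (tY : Coord m →L[ℝ] Coord m)
    (D : Coord n →L[ℝ] Coord m) (ζ' v : Coord m) :
    tY.comp ((glue D B ζ ζ' v).comp oX) =
      glue (tY.comp (D.comp oS)) (tX.comp (B.comp oS)) (tX ζ) (tY ζ') (tY v) := by
  -- The conjugated map has the required restriction, so `eq_glue` identifies it up to its velocity,
  -- which is its value on `tX ζ` minus `tY ζ'`.
  have h1 := (h.conj (Function.LeftInverse.injective hX) hS).eq_glue (D := tY.comp (D.comp oS))
    (g := tY.comp ((glue D B ζ ζ' v).comp oX)) (fun a => by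
      simp only [ContinuousLinearMap.comp_apply, hX, h.glue_image]) (tY ζ')
  rw [h1]
  congr 1
  simp only [ContinuousLinearMap.comp_apply, hX, h.glue_normal, map_add, add_sub_cancel_right]

/-- The jet reconstructed from a smooth velocity is smooth. -/
theorem contMDiff_reconstruct (hτ : Manifold.IsSmoothEmbedding (𝓡 n) (𝓡 (n + 1)) ∞ τ)
    (ζ : InfSlicing pr τ) (φ : Config pr τ) (v : Velocity φ) :
    ContMDiff (𝓡 n) (preJetModel n m) ∞
      (fun x => (⟨φ.toFun x, reconstruct ζ φ x (v.toFun x)⟩ : PreJetBundle pr)) := by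
  intro x₀
  have hφ := φ.smooth x₀
  have hpφ : ContMDiffAt (𝓡 n) (𝓡 (n + 1)) ∞ (fun x => pr (φ.toFun x)) x₀ :=
    (pr.contMDiff (φ.toFun x₀)).comp x₀ hφ
  refine contMDiffAt_preJet_iff.2 ⟨hφ, ?_⟩
  have hζX := contMDiffAt_tangent_iff.1 (ζ.contMDiff_onX φ x₀)
  have hζY := contMDiffAt_tangent_iff.1 (ζ.contMDiff_onY φ x₀)
  have hv := contMDiffAt_tangent_iff.1 (v.smooth x₀)
  have hD := contMDiffAt_mfderiv_coord hφ
  have hB := contMDiffAt_mfderiv_coord hpφ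
  have hS : ∀ {x : S}, x ∈ chartDom (d := n) x₀ → Function.Injective (ofC (d := n) x₀ x) :=
    fun hx => (coordEquiv hx).symm.injective
  have hsplit := (isSplit_baseDeriv hτ ζ φ x₀).conj
    (Function.LeftInverse.injective (ofC_toC (mem_chartDom (d := n + 1) (pr (φ.toFun x₀)))))
    (hS (mem_chartDom x₀))
  refine (contMDiffAt_glue hD hB hζX.2 hζY.2 hv.2 hsplit).congr_of_eventuallyEq ?_
  filter_upwards [eventually_mem_chartDom (d := n) (f := id) continuousAt_id,
    eventually_mem_chartDom (d := n + 1) hpφ.continuousAt] with x hx hX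
  exact (isSplit_baseDeriv hτ ζ φ x).glue_conj (ofC_toC hX) (hS hx)
    (toC (d := m) (φ.toFun x₀) (φ.toFun x)) (φ.deriv x) (ζ.onY (φ.toFun x)) (v.toFun x)

/-- The jet reconstructed from a velocity. -/
def HolonomicJet.ofVelocity (hτ : Manifold.IsSmoothEmbedding (𝓡 n) (𝓡 (n + 1)) ∞ τ)
    (ζ : InfSlicing pr τ) {φ : Config pr τ} (v : Velocity φ) : HolonomicJet φ where
  toFun x := reconstruct ζ φ x (v.toFun x)
  isJet x := isJet_iff.2 <| by
    let T : Coord m →L[ℝ] Coord (n + 1) := mfderiv (𝓡 m) (𝓡 (n + 1)) pr (φ.toFun x)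
    let D : Coord n →L[ℝ] Coord m := φ.deriv x
    exact (isSplit_baseDeriv hτ ζ φ x).comp_glue (T := T) (D := D) (φ.baseDeriv_apply x)
      (ζ.projects_field φ x) (v.vertical x)
  smooth := contMDiff_reconstruct hτ ζ φ v
  holonomic x := by
    let D : Coord n →L[ℝ] Coord m := φ.deriv x
    let ζ' : Coord m := ζ.onY (φ.toFun x)
    let w : Coord m := v.toFun x
    have h : ∀ a, glue D _ _ ζ' w _ = D a := (isSplit_baseDeriv hτ ζ φ x).glue_image D ζ' w
    exact ContinuousLinearMap.ext h

/-- The velocity of a holonomic jet relative to a slicing. -/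
def HolonomicJet.velocity (ζ : InfSlicing pr τ) {φ : Config pr τ} (γ : HolonomicJet φ) :
    Velocity φ where
  toFun x := γ.toFun x (ζ.onX (pr (φ.toFun x))) - ζ.onY (φ.toFun x)
  vertical x := by
    change mfderiv (𝓡 m) (𝓡 (n + 1)) pr (φ.toFun x) _ = 0
    rw [map_sub, isJet_iff.1 (γ.isJet x), ζ.projects_field φ x, sub_self]
  smooth := by
    intro x₀
    have hζX := contMDiffAt_tangent_iff.1 (ζ.contMDiff_onX φ x₀)
    have hζY := contMDiffAt_tangent_iff.1 (ζ.contMDiff_onY φ x₀)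
    have hγ := contMDiffAt_preJet_iff.1 (γ.smooth x₀)
    refine contMDiffAt_tangent_iff.2 ⟨φ.smooth x₀, ?_⟩
    refine ((hγ.2.clm_apply hζX.2).sub hζY.2).congr_of_eventuallyEq ?_
    filter_upwards [eventually_mem_chartDom (d := n + 1) hζX.1.continuousAt] with x hX
    change _ = toC _ _ (γ.toFun x (ofC _ _ (toC _ _ _))) - _
    rw [ofC_toC hX, map_sub]

end Fields

/-! ### Holonomic lifts and the energy-momentum density -/

section Lifts

variable {n m : ℕ} {X Y S : Type*}
  [TopologicalSpace X] [ChartedSpace (Coord (n + 1)) X] [IsManifold (𝓡 (n + 1)) ∞ X]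
  [TopologicalSpace Y] [ChartedSpace (Coord m) Y] [IsManifold (𝓡 m) ∞ Y]
  [TopologicalSpace S] [ChartedSpace (Coord n) S] [IsManifold (𝓡 n) ∞ S]
  {pr : C^∞⟮𝓡 m, Y; 𝓡 (n + 1), X⟯} {τ : S → X}
  {𝔤 : Type*} [AddCommGroup 𝔤] [Module ℝ 𝔤]

/-- The contraction of the first slot of a form at a point of `Y` with a tangent vector. -/
def contract {y : Y} (z : Form (d := m) (n + 1) y) (p : Fin n → TangentSpace (𝓡 m) y)
    (w : TangentSpace (𝓡 m) y) : ℝ :=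
  slot (E := Coord m) z p w

/-- The energy-momentum density in terms of the generators of the action on `Y`. -/
theorem energyMomentumDensity_apply (A : BundleAction 𝔤 pr) {φ : Config pr τ}
    (σ : MultimomentumField φ) (ξ : 𝔤) (x : S) (u : Fin n → TangentSpace (𝓡 n) x) :
    energyMomentumDensity A σ ξ x u =
      contract (σ.toFun x) (fun i => φ.deriv x (u i)) (A.gen ξ (φ.toFun x)) := by
  have hp := hasMFDerivAt_formBundle_proj (σ.toMap x)
  have hσ : MDifferentiableAt (𝓡 n) (formModel m (n + 1)) σ.toMap x :=
    (σ.smooth x).mdifferentiableAt (by simp)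
  have h1 : ∀ w, mfderiv (formModel m (n + 1)) (𝓡 m)
      (TotalSpace.proj : FormBundle m Y (n + 1) → Y) (σ.toMap x)
      (mfderiv (𝓡 n) (formModel m (n + 1)) σ.toMap x w) = φ.deriv x w := fun w =>
    (DFunLike.congr_fun (mfderiv_comp x hp.mdifferentiableAt hσ) w).symm
  have h2 : mfderiv (formModel m (n + 1)) (𝓡 m)
      (TotalSpace.proj : FormBundle m Y (n + 1) → Y) (σ.toMap x)
      (canonicalLift (A.gen ξ) (σ.toMap x)) = A.gen ξ (φ.toFun x) :=
    DFunLike.congr_fun hp.mfderiv (canonicalLift (A.gen ξ) (σ.toMap x))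
  refine congrArg (fun p : Fin (n + 1) → Coord m =>
    (show Coord m [⋀^Fin (n + 1)]→L[ℝ] ℝ from σ.toFun x) p) (funext fun i => ?_)
  refine Fin.cases ?_ (fun i => ?_) i
  · exact h2
  · exact h1 (u i)

/-- The momentum of a Legendre transform is the fibre derivative of the instantaneous
Lagrangian at the corresponding velocity. -/
theorem contract_eq_instMomentum {L : LagrangianDensity pr} {ζ : InfSlicing pr τ}
    {φ : Config pr τ} {x : S}
    (h : IsSplit (n := n) (φ.baseDeriv x) (ζ.onX (pr (φ.toFun x))))
    {γ : PreJet pr (φ.toFun x)} (hγ : IsJet γ) (hhol : ∀ a, γ (φ.baseDeriv x a) = φ.deriv x a)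
    {z : Form (d := m) (n + 1) (φ.toFun x)} (hz : IsLegendre L γ z)
    {w : TangentSpace (𝓡 m) (φ.toFun x)} (hw : w ∈ Vertical pr (φ.toFun x))
    (u : Fin n → TangentSpace (𝓡 n) x) :
    contract z (fun i => φ.deriv x (u i)) w =
      instMomentum L ζ φ x (γ (ζ.onX (pr (φ.toFun x))) - ζ.onY (φ.toFun x)) w u := by
  let T : Coord m →L[ℝ] Coord (n + 1) := mfderiv (𝓡 m) (𝓡 (n + 1)) pr (φ.toFun x)
  let D : Coord n →L[ℝ] Coord m := φ.deriv x
  let ζ' : Coord m := ζ.onY (φ.toFun x)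
  let g : Coord (n + 1) →L[ℝ] Coord m := γ
  let Λ : (Coord (n + 1) →L[ℝ] Coord m) → Coord (n + 1) [⋀^Fin (n + 1)]→L[ℝ] ℝ :=
    L.toFun (φ.toFun x)
  exact h.slot_eq_deriv (T := T) (D := D) (ζ' := ζ') (Λ := Λ) (g := g) (isJet_iff.1 hγ) hhol
    (z := z) (fun γ' hγ' v => hz.2 γ' (isJet_iff.2 hγ') v) (w := w) hw u

/-- Two Legendre transforms of holonomic jets with the same momenta, whose velocities are joined by
a curve in a fibre of the fibre derivative, have the same contractions. -/
theorem contract_eq_contract {L : LagrangianDensity pr} {ζ : InfSlicing pr τ}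
    {φ : Config pr τ} {x : S}
    (h : IsSplit (n := n) (φ.baseDeriv x) (ζ.onX (pr (φ.toFun x))))
    {γ γ' : PreJet pr (φ.toFun x)} (hγ : IsJet γ) (hγ' : IsJet γ')
    (hhol : ∀ a, γ (φ.baseDeriv x a) = φ.deriv x a)
    (hhol' : ∀ a, γ' (φ.baseDeriv x a) = φ.deriv x a)
    {z z' : Form (d := m) (n + 1) (φ.toFun x)} (hz : IsLegendre L γ z) (hz' : IsLegendre L γ' z')
    (u : Fin n → TangentSpace (𝓡 n) x)
    (hzz' : ∀ w ∈ Vertical pr (φ.toFun x), contract z (fun i => φ.deriv x (u i)) w =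
      contract z' (fun i => φ.deriv x (u i)) w)
    {c : ℝ → Coord m} (hc : ContDiff ℝ ∞ c)
    (hc0 : c 0 = γ (ζ.onX (pr (φ.toFun x))) - ζ.onY (φ.toFun x))
    (hc1 : c 1 = γ' (ζ.onX (pr (φ.toFun x))) - ζ.onY (φ.toFun x))
    (hcT : ∀ s ∈ Set.Icc (0 : ℝ) 1, c s ∈ Vertical pr (φ.toFun x))
    (hcM : ∀ s ∈ Set.Icc (0 : ℝ) 1, ∀ w ∈ Vertical pr (φ.toFun x),
      instMomentum L ζ φ x (c s) w u = contract z (fun i => φ.deriv x (u i)) w)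
    (η : TangentSpace (𝓡 m) (φ.toFun x)) :
    contract z (fun i => φ.deriv x (u i)) η = contract z' (fun i => φ.deriv x (u i)) η := by
  let T : Coord m →L[ℝ] Coord (n + 1) := mfderiv (𝓡 m) (𝓡 (n + 1)) pr (φ.toFun x)
  let D : Coord n →L[ℝ] Coord m := φ.deriv x
  let ζ' : Coord m := ζ.onY (φ.toFun x)
  let g : Coord (n + 1) →L[ℝ] Coord m := γ
  let g' : Coord (n + 1) →L[ℝ] Coord m := γ'
  let Λ : (Coord (n + 1) →L[ℝ] Coord m) → Coord (n + 1) [⋀^Fin (n + 1)]→L[ℝ] ℝ :=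
    L.toFun (φ.toFun x)
  -- At `γ' = γ` the first-order term of the Taylor formula vanishes.
  have hself : ∀ (γ : PreJet pr (φ.toFun x)) (z : Form (d := m) (n + 1) (φ.toFun x)),
      IsJet γ → IsLegendre L γ z → ∀ v : Fin (n + 1) → TangentSpace (𝓡 (n + 1)) (pr (φ.toFun x)),
      (show ℝ from z (fun i => γ (v i))) = (show ℝ from L.toFun (φ.toFun x) γ v) := by
    intro γ z hγ hz v
    have h1 := hz.2 γ hγ v
    simp only [sub_self, smul_zero, deriv_const, add_zero] at h1
    exact h1
  exact h.slot_eq_slot (T := T) (D := D) (ζ' := ζ') (Λ := Λ) (g := g) (g' := g')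
    (φ.baseDeriv_apply x)
    (fun f hf hT Ω => contDiff_lagrangian L (φ.toFun x) f hf (fun w => isJet_iff.2 (hT w)) Ω)
    (isJet_iff.1 hγ) hhol (isJet_iff.1 hγ') hhol' (z := z) (z' := z')
    (hself γ z hγ hz) (hself γ' z' hγ' hz') u hzz' hc hc0 hc1 hcT hcM η

/-- The momentum condition for a holonomic lift. -/
theorem IsHolonomicLift.contract_eq {L : LagrangianDensity pr} {P : Phase pr τ}
    {σ : MultimomentumField P.field} (h : IsHolonomicLift L P σ) (x : S)
    (v : Vertical pr (P.field.toFun x)) (u : Fin n → TangentSpace (𝓡 n) x) :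
    contract (σ.toFun x) (fun i => P.field.deriv x (u i)) v = P.mom x v u :=
  DFunLike.congr_fun (h.2 x v) u

theorem HolonomicJet.holonomic_apply {φ : Config pr τ} (γ : HolonomicJet φ) (x : S)
    (a : TangentSpace (𝓡 n) x) : γ.toFun x (φ.baseDeriv x a) = φ.deriv x a :=
  DFunLike.congr_fun (γ.holonomic x) a

/-- Every point of the primary constraint set has a holonomic lift. -/
theorem exists_isHolonomicLift (hτ : Manifold.IsSmoothEmbedding (𝓡 n) (𝓡 (n + 1)) ∞ τ)
    {L : LagrangianDensity pr} {ζ : InfSlicing pr τ} {P : Phase pr τ}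
    (hP : P ∈ primaryConstraintSet L ζ) :
    ∃ σ : MultimomentumField P.field, IsHolonomicLift L P σ := by
  obtain ⟨v, hv⟩ := hP
  let γ := HolonomicJet.ofVelocity hτ ζ v
  choose s hs hs' using fun x => exists_isLegendre L (γ.isJet x)
  refine ⟨⟨s, fun x => (hs x).1, fun x₀ => contMDiffAt_legendre L γ.isJet (γ.smooth x₀) s hs'⟩,
    ⟨γ, hs⟩, fun x w => ?_⟩
  refine ContinuousAlternatingMap.ext fun u => ?_
  have h0 := isSplit_baseDeriv hτ ζ P.field x
  have h1 := contract_eq_instMomentum h0 (γ.isJet x) (γ.holonomic_apply x) (hs x) w.2 u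
  have h2 : γ.toFun x (ζ.onX (pr (P.field.toFun x))) - ζ.onY (P.field.toFun x) = v.toFun x := by
    let D : Coord n →L[ℝ] Coord m := P.field.deriv x
    let ζ' : Coord m := ζ.onY (P.field.toFun x)
    let w : Coord m := v.toFun x
    exact sub_eq_of_eq_add (h0.glue_normal D ζ' w)
  rw [h2] at h1
  exact h1.trans (hv x w u).symm

/-- The velocity of the jet underlying a holonomic lift of `(φ, π)` lies in the fibre of the
instantaneous Legendre transform over `(φ, π)`. -/
theorem IsHolonomicLift.isInstLegendre (hτ : Manifold.IsSmoothEmbedding (𝓡 n) (𝓡 (n + 1)) ∞ τ)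
    {L : LagrangianDensity pr} (ζ : InfSlicing pr τ) {P : Phase pr τ}
    {σ : MultimomentumField P.field} (h : IsHolonomicLift L P σ) {γ : HolonomicJet P.field}
    (hγ : ∀ x, IsLegendre L (γ.toFun x) (σ.toFun x)) : IsInstLegendre L ζ P (γ.velocity ζ) :=
  fun x w u => (h.contract_eq x w u).symm.trans
    (contract_eq_instMomentum (isSplit_baseDeriv hτ ζ P.field x) (γ.isJet x)
      (γ.holonomic_apply x) (hγ x) w.2 u)

/-- If the fibres of the instantaneous Legendre transform are connected, the contractions of
holonomic lifts depend only on the point of the phase space. -/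
theorem HasConnectedFibres.contract_eq (hτ : Manifold.IsSmoothEmbedding (𝓡 n) (𝓡 (n + 1)) ∞ τ)
    {L : LagrangianDensity pr} {ζ : InfSlicing pr τ} (hA : HasConnectedFibres L ζ)
    {P : Phase pr τ} {σ σ' : MultimomentumField P.field} (h : IsHolonomicLift L P σ)
    (h' : IsHolonomicLift L P σ') (x : S) (u : Fin n → TangentSpace (𝓡 n) x)
    (η : TangentSpace (𝓡 m) (P.field.toFun x)) :
    contract (σ.toFun x) (fun i => P.field.deriv x (u i)) η =
      contract (σ'.toFun x) (fun i => P.field.deriv x (u i)) η := by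
  obtain ⟨γ, hγ⟩ := h.1
  obtain ⟨γ', hγ'⟩ := h'.1
  obtain ⟨c, hc, hc0, hc1, hcM⟩ := hA P _ _ (h.isInstLegendre hτ ζ hγ)
    (h'.isInstLegendre hτ ζ hγ')
  -- Freezing `x` turns the smooth curve of sections into a smooth curve in one tangent space.
  have hcs : ContDiff ℝ ∞ (fun s => (show Coord m from (c s).toFun x)) := by
    rw [← contMDiff_iff_contDiff]
    intro s₀
    have h1 := (hc (s₀, x)).comp s₀
      (contMDiffAt_id.prodMk contMDiffAt_const : ContMDiffAt 𝓘(ℝ, ℝ) (𝓘(ℝ, ℝ).prod (𝓡 n)) ∞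
        (fun s : ℝ => (s, x)) s₀)
    have h2 := (contMDiffAt_tangent_iff (f := fun _ : ℝ => P.field.toFun x)
      (s := fun s => (c s).toFun x)).1 h1
    let o : Coord m →L[ℝ] Coord m := ofC (P.field.toFun x) (P.field.toFun x)
    refine (o.contMDiff.contMDiffAt.comp s₀ h2.2).congr_of_eventuallyEq
      (Filter.Eventually.of_forall fun s => ?_)
    exact (ofC_toC (mem_chartDom _) ((c s).toFun x)).symm
  refine contract_eq_contract (isSplit_baseDeriv hτ ζ P.field x) (γ.isJet x) (γ'.isJet x)
    (γ.holonomic_apply x) (γ'.holonomic_apply x) (hγ x) (hγ' x) u (fun w hw => ?_) hcs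
    (congrArg (fun v : Velocity P.field => v.toFun x) hc0)
    (congrArg (fun v : Velocity P.field => v.toFun x) hc1) (fun s _ => (c s).vertical x)
    (fun s hs w hw => ?_) η
  · exact (h.contract_eq x ⟨w, hw⟩ u).trans (h'.contract_eq x ⟨w, hw⟩ u).symm
  · exact (hcM s hs x ⟨w, hw⟩ u).symm.trans (h.contract_eq x ⟨w, hw⟩ u).symm

/-- If the fibres of the fibre derivatives are connected, the contractions at `x` of
Legendre transforms of holonomic jets depend only on `j¹φ(x)` and the momenta. -/
theorem HasConnectedFibresPointwise.contract_eq_of_jet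
    (hτ : Manifold.IsSmoothEmbedding (𝓡 n) (𝓡 (n + 1)) ∞ τ)
    {L : LagrangianDensity pr} {ζ : InfSlicing pr τ} (hB : HasConnectedFibresPointwise L ζ)
    {φ : Config pr τ} {x : S} {γ : PreJet pr (φ.toFun x)} (hγ : IsJet γ)
    (hhol : ∀ a, γ (φ.baseDeriv x a) = φ.deriv x a)
    {z : Form (d := m) (n + 1) (φ.toFun x)} (hz : IsLegendre L γ z)
    {y : Y} {D : TangentSpace (𝓡 n) x →L[ℝ] TangentSpace (𝓡 m) y}
    (hD : ∀ u, (⟨φ.toFun x, φ.deriv x u⟩ : TangentBundle (𝓡 m) Y) = ⟨y, D u⟩)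
    {γ' : PreJet pr y} (hγ' : IsJet γ')
    (hhol' : ∀ a, γ' (mfderiv (𝓡 m) (𝓡 (n + 1)) pr y (D a)) = D a)
    {z' : Form (d := m) (n + 1) y} (hz' : IsLegendre L γ' z')
    (hzz' : ∀ u : Fin n → TangentSpace (𝓡 n) x, ∀ w ∈ Vertical pr (φ.toFun x), ∀ w' ∈ Vertical pr y,
      (⟨φ.toFun x, w⟩ : TangentBundle (𝓡 m) Y) = ⟨y, w'⟩ →
      contract z (fun i => φ.deriv x (u i)) w = contract z' (fun i => D (u i)) w')
    (u : Fin n → TangentSpace (𝓡 n) x) (η : ∀ y : Y, TangentSpace (𝓡 m) y) :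
    contract z (fun i => φ.deriv x (u i)) (η (φ.toFun x)) =
      contract z' (fun i => D (u i)) (η y) := by
  -- Equality of jets is expressed in `TangentBundle`, and `y`, `D` are free variables, so the base
  -- points (read off at the zero vector) and then the derivatives can be identified by
  -- substitution.
  obtain rfl : φ.toFun x = y := congrArg TotalSpace.proj (hD 0)
  obtain rfl : φ.deriv x = D := ContinuousLinearMap.ext fun u =>
    TotalSpace.mk_injective _ (hD u)
  have h0 := isSplit_baseDeriv hτ ζ φ x
  have hhol'' : ∀ a, γ' (φ.baseDeriv x a) = φ.deriv x a := fun a =>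
    (congrArg γ' (φ.baseDeriv_apply x a)).symm.trans (hhol' a)
  have hvert : ∀ γ : PreJet pr (φ.toFun x), IsJet γ →
      γ (ζ.onX (pr (φ.toFun x))) - ζ.onY (φ.toFun x) ∈ Vertical pr (φ.toFun x) := by
    intro γ hγ
    change mfderiv (𝓡 m) (𝓡 (n + 1)) pr (φ.toFun x) _ = 0
    rw [map_sub, isJet_iff.1 hγ, ζ.projects_field φ x, sub_self]
  obtain ⟨c, hc, hc0, hc1, hcM⟩ := hB φ x _ _ (hvert γ hγ) (hvert γ' hγ') (fun w hw u =>
    (contract_eq_instMomentum h0 hγ hhol hz hw u).symm.trans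
      ((hzz' u w hw w hw rfl).trans (contract_eq_instMomentum h0 hγ' hhol'' hz' hw u)))
  exact contract_eq_contract h0 hγ hγ' hhol hhol'' hz hz' u (fun w hw => hzz' u w hw w hw rfl) hc
    hc0 hc1 (fun s hs => (hcM s hs).1) (fun s hs w hw => ((hcM s hs).2 w hw u).trans
      (contract_eq_instMomentum h0 hγ hhol hz hw u).symm) _

/-- The energy-momentum density at `x` depends only on `j¹φ(x)` and `π(x)`. -/
theorem HasConnectedFibresPointwise.energyMomentumDensity_eq
    (hτ : Manifold.IsSmoothEmbedding (𝓡 n) (𝓡 (n + 1)) ∞ τ)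
    {L : LagrangianDensity pr} (A : BundleAction 𝔤 pr) {ζ : InfSlicing pr τ}
    (hB : HasConnectedFibresPointwise L ζ) {P P' : Phase pr τ} {x : S}
    (hj : ∀ u : TangentSpace (𝓡 n) x,
      (⟨P.field.toFun x, P.field.deriv x u⟩ : TangentBundle (𝓡 m) Y) =
        ⟨P'.field.toFun x, P'.field.deriv x u⟩)
    (hmom : ∀ (v : Vertical pr (P.field.toFun x)) (v' : Vertical pr (P'.field.toFun x)),
      (⟨P.field.toFun x, v⟩ : TangentBundle (𝓡 m) Y) = ⟨P'.field.toFun x, v'⟩ →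
        P.mom x v = P'.mom x v')
    {σ : MultimomentumField P.field} {σ' : MultimomentumField P'.field}
    (h : IsHolonomicLift L P σ) (h' : IsHolonomicLift L P' σ') (ξ : 𝔤) :
    energyMomentumDensity A σ ξ x = energyMomentumDensity A σ' ξ x := by
  obtain ⟨γ, hγ⟩ := h.1
  obtain ⟨γ', hγ'⟩ := h'.1
  refine ContinuousAlternatingMap.ext fun u => ?_
  refine (energyMomentumDensity_apply A σ ξ x u).trans
    (Eq.trans ?_ (energyMomentumDensity_apply A σ' ξ x u).symm)
  refine hB.contract_eq_of_jet hτ (γ.isJet x) (γ.holonomic_apply x) (hγ x) hj (γ'.isJet x)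
    (fun a => ?_) (hγ' x) (fun u w hw w' hw' e => ?_) u (A.gen ξ)
  · exact (congrArg (γ'.toFun x) (P'.field.baseDeriv_apply x a)).trans (γ'.holonomic_apply x a)
  · refine (h.contract_eq x ⟨w, hw⟩ u).trans (Eq.trans ?_ (h'.contract_eq x ⟨w', hw'⟩ u).symm)
    exact DFunLike.congr_fun (hmom ⟨w, hw⟩ ⟨w', hw'⟩ e) u

/-- The energy-momentum density of holonomic lifts depends only on the point of the phase space. -/
theorem energyMomentumDensity_eq (hτ : Manifold.IsSmoothEmbedding (𝓡 n) (𝓡 (n + 1)) ∞ τ)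
    {L : LagrangianDensity pr} (A : BundleAction 𝔤 pr) {ζ : InfSlicing pr τ}
    (hAB : HasConnectedFibres L ζ ∨ HasConnectedFibresPointwise L ζ) {P : Phase pr τ}
    {σ σ' : MultimomentumField P.field} (h : IsHolonomicLift L P σ) (h' : IsHolonomicLift L P σ')
    (ξ : 𝔤) (x : S) : energyMomentumDensity A σ ξ x = energyMomentumDensity A σ' ξ x := by
  obtain hA | hB := hAB
  · refine ContinuousAlternatingMap.ext fun u => ?_
    exact (energyMomentumDensity_apply A σ ξ x u).trans
      ((hA.contract_eq hτ h h' x u _).trans (energyMomentumDensity_apply A σ' ξ x u).symm)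
  · refine hB.energyMomentumDensity_eq hτ A (fun _ => rfl) (fun v v' e => ?_) h h' ξ
    rw [Subtype.ext (TotalSpace.mk_injective _ e : (v : TangentSpace (𝓡 m) (P.field.toFun x)) = v')]

/-- The energy-momentum density of a smooth field is smooth. -/
theorem contMDiff_energyMomentumDensity (A : BundleAction 𝔤 pr) {φ : Config pr τ}
    (σ : MultimomentumField φ) (ξ : 𝔤) : ContMDiff (𝓡 n) (formModel n n) ∞
      (fun x => (⟨x, energyMomentumDensity A σ ξ x⟩ : FormBundle n S n)) := by
  intro x₀
  refine (contMDiffAt_form_iff (f := id)).2 ⟨contMDiffAt_id, fun u => ?_⟩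
  have hgen : ContMDiffAt (𝓡 n) (𝓡 m).tangent ∞ (fun x =>
      (⟨φ.toFun x, A.gen ξ (φ.toFun x)⟩ : TangentBundle (𝓡 m) Y)) x₀ :=
    ((A.smooth ξ) (φ.toFun x₀)).comp x₀ (φ.smooth x₀)
  have h1 := contMDiffAt_form_apply (σ.smooth x₀) (w := fun x => Matrix.vecCons
    (A.gen ξ (φ.toFun x)) (fun i => φ.deriv x (ofC x₀ x (u i)))) (fun i => by
      refine Fin.cases ?_ (fun i => ?_) i
      · exact (contMDiffAt_tangent_iff.1 hgen).2
      · exact (contMDiffAt_mfderiv_coord (φ.smooth x₀)).clm_apply contMDiffAt_const)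
  refine h1.congr_of_eventuallyEq (Filter.Eventually.of_forall fun x => ?_)
  exact energyMomentumDensity_apply A σ ξ x _

/-- The energy-momentum density as a linear function of the generator. -/
def energyMomentumLinear (A : BundleAction 𝔤 pr) {φ : Config pr τ} (σ : MultimomentumField φ) :
    𝔤 →ₗ[ℝ] (∀ x : S, Form (d := n) n x) where
  toFun ξ x := energyMomentumDensity A σ ξ x
  map_add' ξ ξ' := by
    refine funext fun x => ContinuousAlternatingMap.ext fun u => ?_
    refine (energyMomentumDensity_apply A σ _ x u).trans ?_
    refine Eq.trans ?_ (congrArg₂ (fun a b : ℝ => a + b) (energyMomentumDensity_apply A σ ξ x u)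
      (energyMomentumDensity_apply A σ ξ' x u)).symm
    rw [map_add]
    exact map_add (slot (E := Coord m) (σ.toFun x) _) _ _
  map_smul' r ξ := by
    refine funext fun x => ContinuousAlternatingMap.ext fun u => ?_
    refine (energyMomentumDensity_apply A σ _ x u).trans ?_
    refine Eq.trans ?_ (congrArg (fun a : ℝ => r * a) (energyMomentumDensity_apply A σ ξ x u)).symm
    rw [map_smul]
    exact map_smul (slot (E := Coord m) (σ.toFun x) _) _ _

end Lifts

/-! ### Linearity of the integral of smooth top forms -/

section Integration

variable {n : ℕ} {S : Type*} [TopologicalSpace S] [ChartedSpace (Coord n) S]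
  [IsManifold (𝓡 n) ∞ S]

/-- The coefficient of a smooth form in the frame of a chart is smooth. -/
theorem contMDiffAt_form_coefficient {k : ℕ} {α : ∀ x : S, Form (d := n) k x} {c x : S}
    (hα : ContMDiffAt (𝓡 n) (formModel n k) ∞ (fun x => (⟨x, α x⟩ : FormBundle n S k)) x)
    (hx : x ∈ chartDom (d := n) c) (v : Fin k → Coord n) :
    ContMDiffAt (𝓡 n) 𝓘(ℝ, ℝ) ∞ (fun x => (show ℝ from α x fun i => ofC c x (v i))) x := by
  refine contMDiffAt_form_apply (f := id) hα (w := fun x i => ofC c x (v i)) fun i => ?_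
  have h1 : ContMDiffAt (𝓡 n) 𝓘(ℝ, Coord n →L[ℝ] Coord n) ∞ (fun p : S =>
      (((trivializationAt (Coord n) (TangentSpace (𝓡 n) : S → Type) c).coordChangeL ℝ
        (trivializationAt (Coord n) (TangentSpace (𝓡 n) : S → Type) x) p :
          Coord n ≃L[ℝ] Coord n) : Coord n →L[ℝ] Coord n)) x :=
    contMDiffAt_coordChangeL hx (mem_chartDom x)
  refine (h1.clm_apply (contMDiffAt_const (c := v i))).congr_of_eventuallyEq ?_
  filter_upwards [(Trivialization.open_baseSet _).mem_nhds hx,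
    (Trivialization.open_baseSet _).mem_nhds (mem_chartDom (d := n) x)] with p hp hp'
  refine Eq.trans ?_ (Trivialization.coordChangeL_apply _ _ ⟨hp, hp'⟩ (v i)).symm
  refine (congrFun (Trivialization.coe_linearMapAt_of_mem (R := ℝ) _ hp') _).trans ?_
  refine congrArg (fun w : TangentSpace (𝓡 n) p =>
    (trivializationAt (Coord n) (TangentSpace (𝓡 n) : S → Type) x ⟨p, w⟩).2) ?_
  exact Trivialization.symmL_apply _ hp (v i)

variable [CompactSpace S] [T2Space S]

theorem chartPartition_isSubordinate : (chartPartition (n := n) S).IsSubordinate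
    fun x => (chartAt (Coord n) x).source :=
  Classical.choose_spec (SmoothPartitionOfUnity.exists_isSubordinate_chartAt_source (𝓡 n) S)

/-- The integrand of `integralForm` in the chart at `c`. -/
def integrandForm (α : ∀ x : S, Form (d := n) n x) (c : S) (u : Coord n) : ℝ :=
  (chartPartition (n := n) S c ((extChartAt (𝓡 n) c).symm u) : ℝ) *
    (show ℝ from α ((extChartAt (𝓡 n) c).symm u) (fun i : Fin n =>
      ofC c ((extChartAt (𝓡 n) c).symm u) (EuclideanSpace.single i (1 : ℝ))))

theorem integralForm_eq (α : ∀ x : S, Form (d := n) n x) :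
    integralForm α = ∑ᶠ c : S, ∫ u in (extChartAt (𝓡 n) c).target, integrandForm α c u := rfl

/-- The chart target need not be compact, but the partition function is supported in a compact part
of the chart domain, off whose image the integrand vanishes. -/
theorem integrableOn_integrandForm {α : ∀ x : S, Form (d := n) n x}
    (hα : ContMDiff (𝓡 n) (formModel n n) ∞ (fun x => (⟨x, α x⟩ : FormBundle n S n))) (c : S) :
    IntegrableOn (integrandForm α c) (extChartAt (𝓡 n) c).target := by
  have hsub : tsupport (chartPartition (n := n) S c) ⊆ (extChartAt (𝓡 n) c).source := by
    rw [extChartAt_source]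
    exact chartPartition_isSubordinate c
  have hsym := continuousOn_extChartAt_symm (I := 𝓡 n) c
  have hcont : ContinuousOn (integrandForm α c) (extChartAt (𝓡 n) c).target := by
    intro u hu
    have hx : (extChartAt (𝓡 n) c).symm u ∈ chartDom (d := n) c := by
      have := (extChartAt (𝓡 n) c).map_target hu
      rwa [extChartAt_source] at this
    have h1 : ContinuousAt (fun x : S => (chartPartition (n := n) S c x : ℝ) *
        (show ℝ from α x fun i => ofC c x (EuclideanSpace.single i (1 : ℝ))))
        ((extChartAt (𝓡 n) c).symm u) :=
      ((chartPartition (n := n) S c).contMDiff.continuous.continuousAt).mul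
        (contMDiffAt_form_coefficient (hα _) hx _).continuousAt
    exact h1.comp_continuousWithinAt (hsym u hu)
  have hK : IsCompact (extChartAt (𝓡 n) c '' tsupport (chartPartition (n := n) S c)) :=
    (isClosed_tsupport _).isCompact.image_of_continuousOn
      ((continuousOn_extChartAt c).mono hsub)
  have hKt : extChartAt (𝓡 n) c '' tsupport (chartPartition (n := n) S c) ⊆
      (extChartAt (𝓡 n) c).target := by
    rintro _ ⟨x, hx, rfl⟩
    exact (extChartAt (𝓡 n) c).map_source (hsub hx)
  refine ((hcont.mono hKt).integrableOn_compact hK).of_forall_sdiff_eq_zero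
    (isOpen_extChartAt_target c).measurableSet ?_
  rintro u ⟨hu, hu'⟩
  have h0 : chartPartition (n := n) S c ((extChartAt (𝓡 n) c).symm u) = 0 := by
    by_contra h
    exact hu' ⟨_, subset_tsupport _ h, (extChartAt (𝓡 n) c).right_inv hu⟩
  rw [integrandForm, h0, zero_mul]

/-- A locally finite family on a compact space has finitely many nonzero members. Without finite
support `finsum` would take its default value and linearity could fail. -/
theorem finite_support_integral_integrandForm (α : ∀ x : S, Form (d := n) n x) :
    (Function.support fun c : S =>
      ∫ u in (extChartAt (𝓡 n) c).target, integrandForm α c u).Finite := by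
  refine ((chartPartition (n := n) S).locallyFinite.finite_nonempty_of_compact).subset ?_
  intro c hc
  by_contra h
  refine hc ?_
  have h0 : ∀ x, chartPartition (n := n) S c x = 0 := by
    intro x
    by_contra hx
    exact h ⟨x, hx⟩
  simp [integrandForm, h0]

/-- Smoothness enters through integrability in each chart, without which the integral need not be
additive; scaling requires no such hypothesis. -/
theorem integralForm_add {α β : ∀ x : S, Form (d := n) n x}
    (hα : ContMDiff (𝓡 n) (formModel n n) ∞ (fun x => (⟨x, α x⟩ : FormBundle n S n)))
    (hβ : ContMDiff (𝓡 n) (formModel n n) ∞ (fun x => (⟨x, β x⟩ : FormBundle n S n))) :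
    integralForm (α + β) = integralForm α + integralForm β := by
  rw [integralForm_eq, integralForm_eq, integralForm_eq, ← finsum_add_distrib
    (finite_support_integral_integrandForm α) (finite_support_integral_integrandForm β)]
  refine finsum_congr fun c => ?_
  rw [← integral_add (integrableOn_integrandForm hα c) (integrableOn_integrandForm hβ c)]
  exact congrArg _ (funext fun u => mul_add _ _ _)

theorem integralForm_smul (r : ℝ) (α : ∀ x : S, Form (d := n) n x) :
    integralForm (r • α) = r * integralForm α := by
  rw [integralForm_eq, integralForm_eq, ← smul_eq_mul, smul_finsum' _
    (finite_support_integral_integrandForm α)]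
  refine finsum_congr fun c => ?_
  rw [← integral_smul]
  exact congrArg _ (funext fun u => mul_left_comm _ _ _)

end Integration

end ClassicalFields

end

/-! ### Descent to the primary constraint set. -/

open ClassicalFields in
theorem proposition7p7 {n m : ℕ} {X Y S 𝔤 : Type*}
    [TopologicalSpace X] [ChartedSpace (Coord (n + 1)) X] [IsManifold (𝓡 (n + 1)) ∞ X]
    [TopologicalSpace Y] [ChartedSpace (Coord m) Y] [IsManifold (𝓡 m) ∞ Y]
    [TopologicalSpace S] [ChartedSpace (Coord n) S] [IsManifold (𝓡 n) ∞ S]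
    [CompactSpace S] [T2Space S] (_hS : IsOrientedAtlas (n := n) S)
    [AddCommGroup 𝔤] [Module ℝ 𝔤]
    (pr : C^∞⟮𝓡 m, Y; 𝓡 (n + 1), X⟯) (_hpr : IsFibered pr)
    (τ : S → X) (_hτ : Manifold.IsSmoothEmbedding (𝓡 n) (𝓡 (n + 1)) ∞ τ)
    (L : LagrangianDensity pr) (A : BundleAction 𝔤 pr) (ζ : InfSlicing pr τ) :
    -- every point of the primary constraint set has a holonomic lift
    (∀ P ∈ primaryConstraintSet L ζ, ∃ σ : MultimomentumField P.field, IsHolonomicLift L P σ) ∧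
    -- the energy-momentum density and the energy-momentum map descend to the primary constraint set
    (HasConnectedFibres L ζ ∨ HasConnectedFibresPointwise L ζ →
      ∃ 𝔈 : primaryConstraintSet L ζ → 𝔤 →ₗ[ℝ] (∀ x : S, Form (d := n) n x),
        (∀ (P : primaryConstraintSet L ζ) (σ : MultimomentumField P.1.field),
          IsHolonomicLift L P.1 σ → ∀ ξ x, 𝔈 P ξ x = energyMomentumDensity A σ ξ x) ∧
        (∀ 𝔈' : primaryConstraintSet L ζ → 𝔤 →ₗ[ℝ] (∀ x : S, Form (d := n) n x),
          (∀ (P : primaryConstraintSet L ζ) (σ : MultimomentumField P.1.field),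
            IsHolonomicLift L P.1 σ → ∀ ξ x, 𝔈' P ξ x = energyMomentumDensity A σ ξ x) → 𝔈' = 𝔈) ∧
        (∀ P ξ, ContMDiff (𝓡 n) (formModel n n) ∞
          (fun x => (⟨x, 𝔈 P ξ x⟩ : FormBundle n S n))) ∧
        ∃! ℰ : primaryConstraintSet L ζ → Module.Dual ℝ 𝔤,
          ∀ P ξ, ℰ P ξ = integralForm (𝔈 P ξ)) ∧
    -- the energy-momentum density at `x` depends only on `j¹φ(x)` and `π(x)`
    (HasConnectedFibresPointwise L ζ →
      ∀ P ∈ primaryConstraintSet L ζ, ∀ P' ∈ primaryConstraintSet L ζ, ∀ x : S,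
        (∀ u : TangentSpace (𝓡 n) x,
          (⟨P.field.toFun x, P.field.deriv x u⟩ : TangentBundle (𝓡 m) Y) =
            ⟨P'.field.toFun x, P'.field.deriv x u⟩) →
        (∀ (v : Vertical pr (P.field.toFun x)) (v' : Vertical pr (P'.field.toFun x)),
          (⟨P.field.toFun x, v⟩ : TangentBundle (𝓡 m) Y) = ⟨P'.field.toFun x, v'⟩ →
            P.mom x v = P'.mom x v') →
        ∀ (σ : MultimomentumField P.field) (σ' : MultimomentumField P'.field),
          IsHolonomicLift L P σ → IsHolonomicLift L P' σ' →
            ∀ ξ : 𝔤, energyMomentumDensity A σ ξ x = energyMomentumDensity A σ' ξ x) := by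
  refine ⟨fun P hP => exists_isHolonomicLift _hτ hP, fun hAB => ?_,
    fun hB P _ P' _ x hj hmom σ σ' h h' ξ => hB.energyMomentumDensity_eq _hτ A hj hmom h h' ξ⟩
  -- The density is defined by one chosen lift at each point. Connected fibres give its agreement
  -- with every other lift; the existence of a lift gives uniqueness.
  choose σ hσ using fun P : primaryConstraintSet L ζ => exists_isHolonomicLift _hτ P.2
  have hsmooth : ∀ P ξ, ContMDiff (𝓡 n) (formModel n n) ∞
      (fun x => (⟨x, energyMomentumLinear A (σ P) ξ x⟩ : FormBundle n S n)) :=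
    fun P ξ => contMDiff_energyMomentumDensity A (σ P) ξ
  refine ⟨fun P => energyMomentumLinear A (σ P), fun P σ' h ξ x =>
    energyMomentumDensity_eq _hτ A hAB (hσ P) h ξ x, fun 𝔈' h𝔈' => ?_, hsmooth,
    fun P => { toFun := fun ξ => integralForm (energyMomentumLinear A (σ P) ξ),
               map_add' := fun ξ ξ' => ?_, map_smul' := fun r ξ => ?_ }, fun P ξ => rfl, fun ℰ hℰ => ?_⟩
  · exact funext fun P => LinearMap.ext fun ξ => funext fun x => h𝔈' P (σ P) (hσ P) ξ x
  · rw [map_add]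
    exact integralForm_add (hsmooth P ξ) (hsmooth P ξ')
  · rw [map_smul]
    exact integralForm_smul r _
  · exact funext fun P => LinearMap.ext fun ξ => hℰ P ξ
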